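/- Let $\mu_0$ be a non-negative Radon measure on $(0,+\infty)$ with finite mass $\langle\mu_0,m\rangle<+\infty$, where $\langle\mu,f\rangle=\int_{(0,+\infty)}f(m)\,\mu(\mathrm dm)$, and put $T_{\rm gel}:=1/\langle\mu_0,m^2\rangle\in[0,+\infty]$ (with $1/\infty=0$, $1/0=\infty$). For $\phi\in C_c(0,+\infty)$ (continuous with compact support in $(0,+\infty)$) write $\Delta\phi(m,m')=\phi(m+m')-\phi(m)-\phi(m')$. A family $(\mu_t)_{t\ge0}$ of non-negative Radon measures on $(0,+\infty)$, with value $\mu_0$ at $t=0$, is said to solve * *Smoluchowski's equation* if for all $\phi\in C_c(0,+\infty)$ and $t>0$ $$\langle\mu_t,\phi\rangle=\langle\mu_0,\phi\rangle+\frac12\int_0^t\langle\mu_s(\mathrm dm)\mu_s(\mathrm dm'),\,mm'\Delta\phi(m,m')\rangle\,\mathrm ds;$$ * *Flory's equation* if for all $\phi\in C_c(0,+\infty)$ and $t>0$ $$\langle\mu_t,\phi\rangle=\langle\mu_0,\phi\rangle+\frac12\int_0^t\langle\mu_s(\mathrm dm)\mu_s(\mathrm dm'),\,mm'\Delta\phi(m,m')\rangle\,\mathrm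 ds-\int_0^t\langle\mu_s,\phi\rangle\,\langle\mu_0-\mu_s,m\rangle\,\mathrm ds;$$ where in both cases it is also required that the time integrals above make sense as Lebesgue integrals, that $\int_0^t\langle\mu_s,m\rangle^2\,\mathrm ds<+\infty$ for every $t>0$, and that, if $\langle\mu_0,m^2\rangle<+\infty$, then $t\mapsto\langle\mu_t,m^2\rangle$ is bounded in a right neighbourhood of $0$. Let $(\mu^S_t)_{t\ge0}$ be a solution of Smoluchowski's equation and $(\mu^F_t)_{t\ge0}$ a solution of Flory's equation, both with initial value $\mu_0$. Then 1. $\mu^S_t=\mu^F_t$ for all $0\le t\le T_{\rm gel}$ (with $t$ finite); 2. $\langle\mu^F_t,m\rangle<\langle\mu^S_t,m\rangle$ for all $t>T_{\rm gel}$. -/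

import Mathlib

open MeasureTheory
open scoped ENNReal

namespace Coagulation

/-- The space `(0, +∞)` of particle masses, with its usual topology, Borel σ-algebra and addition.
A nonnegative Radon measure on it is a `Measure MassSpace` that is locally finite
(the space is locally compact with a countable base). -/
abbrev MassSpace : Type := {m : ℝ // 0 < m}

/-- The first moment `⟨μ, m⟩ ∈ [0, +∞]`. -/
noncomputable def firstMoment (μ : Measure MassSpace) : ℝ≥0∞ :=
  ∫⁻ m, ENNReal.ofReal (m : ℝ) ∂μ

/-- The second moment `⟨μ, m²⟩ ∈ [0, +∞]`. -/
noncomputable def secondMoment (μ : Measure MassSpace) : ℝ≥0∞ :=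
  ∫⁻ m, ENNReal.ofReal ((m : ℝ) ^ 2) ∂μ

/-- The gelation time `T_gel = 1 / ⟨μ₀, m²⟩ ∈ [0, +∞]`, with `1 / ∞ = 0` and `1 / 0 = ∞`. -/
noncomputable def gelationTime (μ₀ : Measure MassSpace) : ℝ≥0∞ :=
  (secondMoment μ₀)⁻¹

/-- `Δφ(m, m') = φ(m + m') - φ(m) - φ(m')`. -/
def coagDiff (φ : MassSpace → ℝ) (m m' : MassSpace) : ℝ :=
  φ (m + m') - φ m - φ m'

/-- The coagulation term `⟨μ(dm) μ(dm'), m m' Δφ(m, m')⟩` for the multiplicative kernel. -/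
noncomputable def coagTerm (μ : Measure MassSpace) (φ : MassSpace → ℝ) : ℝ :=
  ∫ p : MassSpace × MassSpace, (p.1 : ℝ) * (p.2 : ℝ) * coagDiff φ p.1 p.2 ∂(μ.prod μ)

/-- The interaction with the gel, `⟨ν, φ⟩ ⟨μ₀ - ν, m⟩ = ⟨ν, φ⟩ (⟨μ₀, m⟩ - ⟨ν, m⟩)`. It is meant for
`⟨μ₀, m⟩ < ∞` and `⟨ν, m⟩ < ∞`. -/
noncomputable def gelTerm (μ₀ ν : Measure MassSpace) (φ : MassSpace → ℝ) : ℝ :=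
  (∫ m, φ m ∂ν) * ((firstMoment μ₀).toReal - (firstMoment ν).toReal)

/-- The family `(μ_t)_{t ≥ 0}` of Radon measures on `(0, +∞)` solves Smoluchowski's equation with
multiplicative kernel, started from its value `μ 0` at time zero (values at negative times are
irrelevant). That the integrand of the time integral is integrable is part of the equation. -/
structure SolvesSmoluchowski (μ : ℝ → Measure MassSpace) : Prop where
  radon : ∀ t, 0 ≤ t → IsLocallyFiniteMeasure (μ t)
  sq_integrable : ∀ t, 0 < t → ∫⁻ s in Set.Ioc 0 t, firstMoment (μ s) ^ 2 < ∞
  equation : ∀ φ : MassSpace → ℝ, Continuous φ → HasCompactSupport φ → ∀ t, 0 < t →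
    IntervalIntegrable (fun s => coagTerm (μ s) φ) volume 0 t ∧
    ∫ m, φ m ∂(μ t) = ∫ m, φ m ∂(μ 0) + 1 / 2 * ∫ s in (0 : ℝ)..t, coagTerm (μ s) φ
  secondMoment_bounded : secondMoment (μ 0) < ∞ →
    ∃ ε : ℝ, 0 < ε ∧ ∃ C : ℝ≥0∞, C < ∞ ∧ ∀ t, 0 ≤ t → t < ε → secondMoment (μ t) ≤ C

/-- The family `(μ_t)_{t ≥ 0}` of Radon measures on `(0, +∞)` solves Flory's equation, started from
its value `μ 0` at time zero (values at negative times are irrelevant). The equation is only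
meaningful when `⟨μ 0, m⟩ < ∞`. -/
structure SolvesFlory (μ : ℝ → Measure MassSpace) : Prop where
  radon : ∀ t, 0 ≤ t → IsLocallyFiniteMeasure (μ t)
  sq_integrable : ∀ t, 0 < t → ∫⁻ s in Set.Ioc 0 t, firstMoment (μ s) ^ 2 < ∞
  equation : ∀ φ : MassSpace → ℝ, Continuous φ → HasCompactSupport φ → ∀ t, 0 < t →
    IntervalIntegrable (fun s => coagTerm (μ s) φ) volume 0 t ∧
    IntervalIntegrable (fun s => gelTerm (μ 0) (μ s) φ) volume 0 t ∧
    ∫ m, φ m ∂(μ t) = ∫ m, φ m ∂(μ 0) + 1 / 2 * (∫ s in (0 : ℝ)..t, coagTerm (μ s) φ)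
      - ∫ s in (0 : ℝ)..t, gelTerm (μ 0) (μ s) φ
  secondMoment_bounded : secondMoment (μ 0) < ∞ →
    ∃ ε : ℝ, 0 < ε ∧ ∃ C : ℝ≥0∞, C < ∞ ∧ ∀ t, 0 ≤ t → t < ε → secondMoment (μ t) ≤ C

end Coagulation

namespace Coagulation

open Set Filter Topology

/-! Put φ_t(x) = ⟨μ_t, 1 - e^{-xm}⟩, with derivative g_t(x) = ⟨μ_t, m e^{-xm}⟩ in x, so that g_t(0)
is the mass. For the multiplicative kernel the coagulation term factorises, and Smoluchowski's
equation becomes ∂_t φ_t(x) = -(1/2)(g_t(0) - g_t(x))². Flory's equation reduces to the same form: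
with K(t) the time integral of the gel mass, e^{K} μ^F solves Smoluchowski's equation run at speed
e^{-K}. Both are therefore instances of `WeightedSolution`, with speed w, total weight W = ∫w and A
= ∫ w g_s(0) ds.

The Hamilton–Jacobi equation is solved by the Legendre transform: at a fixed slope p, φ_t - px
evaluated where g_t = p decreases at rate (w/2)(g_t(0) - p)² (`legendre`). Stationarity in p gives
g_0(x + A - W g_t(x)) = g_t(x) (`characteristic`). At x = 0 this says that l = A - W g_t(0)
satisfies g_0(l) = g_t(0), so A = l + W g_0(l); `mass_integral_le` shows that A is the minimum of y
+ W g_0(y) over y ≥ 0. Hence A depends only on W and the initial value. Convexity of g_0 then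
determines g_t, and so the measure (`eq_of_weight_eq`).

For Flory's equation K(t) = g_0(0) t - A(t). Taking y = 0 in the minimum gives A ≤ g_0(0) W, and a
comparison argument yields W ≤ t and K ≥ 0. Up to T_gel the minimizer is 0, the inequality is an
equality and K = 0, so the two solutions coincide. After T_gel the point 0 is not a minimizer for
weight t, which forces K(t) > 0. Then t e^{-K(t)} < W(t) ≤ t. Since τ g_0(l(τ)) is nondecreasing
along minimizers l(τ) of y + τ g_0(y) (`mul_lap_le_of_isMin`, by log-convexity of g_0), the Flory
mass e^{-K} g_0(l(W)) is strictly below the Smoluchowski mass g_0(l(t)). -/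

/-- The derivative `⟨μ, m e^{-xm}⟩` of the Bernstein transform. -/
noncomputable def lap (μ : Measure MassSpace) (x : ℝ) : ℝ :=
  ∫ m : MassSpace, (m : ℝ) * Real.exp (-(x * m)) ∂μ

/-- The Bernstein transform `⟨μ, 1 - e^{-xm}⟩`. -/
noncomputable def bern (μ : Measure MassSpace) (x : ℝ) : ℝ :=
  ∫ m : MassSpace, (1 - Real.exp (-(x * m))) ∂μ

/-- The negative `⟨μ, m² e^{-xm}⟩` of the second derivative of the Bernstein transform. -/
noncomputable def lapTwo (μ : Measure MassSpace) (x : ℝ) : ℝ :=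
  ∫ m : MassSpace, (m : ℝ) ^ 2 * Real.exp (-(x * m)) ∂μ

/-- The measure has finite first moment. -/
abbrev HasMass (μ : Measure MassSpace) : Prop := Integrable (fun m : MassSpace => (m : ℝ)) μ

/-! ### Finite mass and elementary exponential bounds -/

theorem hasMass_iff {μ : Measure MassSpace} : HasMass μ ↔ firstMoment μ < ∞ := by
  unfold HasMass firstMoment
  constructor
  · intro h
    have := h.2
    rwa [hasFiniteIntegral_iff_ofReal (ae_of_all _ fun m => m.2.le)] at this
  · intro h
    refine ⟨by fun_prop, ?_⟩
    rwa [hasFiniteIntegral_iff_ofReal (ae_of_all _ fun m => m.2.le)]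

theorem lap_zero (μ : Measure MassSpace) : lap μ 0 = ∫ m : MassSpace, (m : ℝ) ∂μ := by
  simp [lap]

theorem toReal_firstMoment (μ : Measure MassSpace) : (firstMoment μ).toReal = lap μ 0 := by
  rw [lap_zero, firstMoment, integral_eq_lintegral_of_nonneg_ae
    (ae_of_all _ fun m => m.2.le) (by fun_prop)]

theorem HasMass.ofReal_lap_zero {μ : Measure MassSpace} (hμ : HasMass μ) :
    ENNReal.ofReal (lap μ 0) = firstMoment μ := by
  rw [← toReal_firstMoment, ENNReal.ofReal_toReal (hasMass_iff.1 hμ).ne]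

theorem exp_neg_mul_le_one {x : ℝ} (hx : 0 ≤ x) (m : MassSpace) :
    Real.exp (-(x * m)) ≤ 1 :=
  Real.exp_le_one_iff.2 (by have := mul_nonneg hx m.2.le; linarith)

theorem one_sub_exp_nonneg {x : ℝ} (hx : 0 ≤ x) (m : MassSpace) :
    0 ≤ 1 - Real.exp (-(x * m)) := sub_nonneg.2 (exp_neg_mul_le_one hx m)

theorem one_sub_exp_le (x : ℝ) (m : MassSpace) :
    1 - Real.exp (-(x * m)) ≤ x * m := by
  have := Real.add_one_le_exp (-(x * m)); linarith

theorem mul_exp_neg_mul_le {x : ℝ} (hx : 0 < x) (m : MassSpace) :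
    (m : ℝ) * Real.exp (-(x * m)) ≤ 1 / x := by
  have h := Real.mul_exp_neg_le_exp_neg_one (x * m)
  have h1 : Real.exp (-1) ≤ 1 := Real.exp_le_one_iff.2 (by norm_num)
  rw [le_div_iff₀ hx]; nlinarith

/-! ### Integrability, monotonicity, derivatives and convexity of the transforms -/

namespace HasMass

variable {μ : Measure MassSpace}

theorem integrable_lap (hμ : HasMass μ) {x : ℝ} (hx : 0 ≤ x) :
    Integrable (fun m : MassSpace => (m : ℝ) * Real.exp (-(x * m))) μ := by
  refine Integrable.mono' hμ (by fun_prop) (ae_of_all _ fun m => ?_)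
  have := m.2
  rw [Real.norm_of_nonneg (by positivity)]
  exact mul_le_of_le_one_right m.2.le (exp_neg_mul_le_one hx m)

theorem integrable_bern (hμ : HasMass μ) {x : ℝ} (hx : 0 ≤ x) :
    Integrable (fun m : MassSpace => 1 - Real.exp (-(x * m))) μ := by
  refine Integrable.mono' (hμ.const_mul x) (by fun_prop) (ae_of_all _ fun m => ?_)
  rw [Real.norm_of_nonneg (one_sub_exp_nonneg hx m)]
  exact one_sub_exp_le x m

theorem integrable_lapTwo (hμ : HasMass μ) {x : ℝ} (hx : 0 < x) :
    Integrable (fun m : MassSpace => (m : ℝ) ^ 2 * Real.exp (-(x * m))) μ := by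
  refine Integrable.mono' (hμ.const_mul (1 / x)) (by fun_prop) (ae_of_all _ fun m => ?_)
  have := m.2
  rw [Real.norm_of_nonneg (by positivity)]
  have h := mul_le_mul_of_nonneg_left (mul_exp_neg_mul_le hx m) m.2.le
  calc _ = (m : ℝ) * (m * Real.exp (-(x * m))) := by ring
    _ ≤ _ := h
    _ = _ := mul_comm _ _

end HasMass

theorem integral_pos_of_pos {μ : Measure MassSpace} (h0 : μ ≠ 0) {f : MassSpace → ℝ}
    (hf : Integrable f μ) (hpos : ∀ m, 0 < f m) : 0 < ∫ m, f m ∂μ := by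
  rw [integral_pos_iff_support_of_nonneg (fun m => (hpos m).le) hf]
  have : Function.support f = univ := eq_univ_of_forall fun m => (hpos m).ne'
  rw [this]
  exact Measure.measure_univ_pos.2 h0

theorem lap_nonneg (μ : Measure MassSpace) (x : ℝ) : 0 ≤ lap μ x :=
  integral_nonneg fun m => mul_nonneg m.2.le (Real.exp_pos _).le

theorem lap_zero_measure (x : ℝ) : lap 0 x = 0 := by simp [lap]

namespace HasMass

variable {μ : Measure MassSpace}

theorem lap_pos (hμ : HasMass μ) (h0 : μ ≠ 0) {x : ℝ} (hx : 0 ≤ x) : 0 < lap μ x :=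
  integral_pos_of_pos h0 (hμ.integrable_lap hx) fun m => mul_pos m.2 (Real.exp_pos _)

theorem lap_anti (hμ : HasMass μ) {x y : ℝ} (hx : 0 ≤ x) (hxy : x ≤ y) : lap μ y ≤ lap μ x := by
  refine integral_mono (hμ.integrable_lap (hx.trans hxy)) (hμ.integrable_lap hx) fun m => ?_
  have := m.2
  exact mul_le_mul_of_nonneg_left (Real.exp_le_exp.2 (by nlinarith)) m.2.le

theorem lap_strictAnti (hμ : HasMass μ) (h0 : μ ≠ 0) {x y : ℝ} (hx : 0 ≤ x) (hxy : x < y) :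
    lap μ y < lap μ x := by
  rw [← sub_pos, lap, lap, ← integral_sub (hμ.integrable_lap hx)
    (hμ.integrable_lap (hx.trans hxy.le))]
  refine integral_pos_of_pos h0 ((hμ.integrable_lap hx).sub
    (hμ.integrable_lap (hx.trans hxy.le))) fun m => ?_
  have := m.2
  rw [sub_pos]
  exact mul_lt_mul_of_pos_left (Real.exp_lt_exp.2 (by nlinarith)) m.2

theorem continuousOn_lap (hμ : HasMass μ) : ContinuousOn (lap μ) (Ici 0) := by
  refine continuousOn_of_dominated (μ := μ)
    (F := fun x (m : MassSpace) => (m : ℝ) * Real.exp (-(x * m)))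
    (bound := fun m : MassSpace => (m : ℝ)) (fun x _ => by fun_prop)
    (fun x hx => ae_of_all _ fun m => ?_) hμ (ae_of_all _ fun m => by fun_prop)
  have := m.2
  rw [Real.norm_of_nonneg (by positivity)]
  exact mul_le_of_le_one_right m.2.le (exp_neg_mul_le_one hx m)

theorem tendsto_lap_atTop (hμ : HasMass μ) : Tendsto (lap μ) atTop (𝓝 0) := by
  have : Tendsto (lap μ) atTop (𝓝 (∫ _m : MassSpace, (0 : ℝ) ∂μ)) := by
    refine tendsto_integral_filter_of_dominated_convergence (fun m => (m : ℝ))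
      (Eventually.of_forall fun x => by fun_prop) ?_ hμ (ae_of_all _ fun m => ?_)
    · filter_upwards [eventually_ge_atTop 0] with x hx
      refine ae_of_all _ fun m => ?_
      have := m.2
      rw [Real.norm_of_nonneg (by positivity)]
      exact mul_le_of_le_one_right m.2.le (exp_neg_mul_le_one hx m)
    · have h : Tendsto (fun x : ℝ => Real.exp (-(x * m))) atTop (𝓝 0) :=
        Real.tendsto_exp_neg_atTop_nhds_zero.comp (tendsto_id.atTop_mul_const m.2)
      simpa using h.const_mul (m : ℝ)
  simpa using this

theorem hasDerivAt_bern (hμ : HasMass μ) {x : ℝ} (hx : 0 < x) :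
    HasDerivAt (bern μ) (lap μ x) x := by
  refine (hasDerivAt_integral_of_dominated_loc_of_deriv_le (Ioi_mem_nhds hx)
    (μ := μ)
    (F := fun x (m : MassSpace) => 1 - Real.exp (-(x * m)))
    (bound := fun m : MassSpace => (m : ℝ)) (F' := fun x (m : MassSpace) => (m : ℝ) * Real.exp (-(x * m)))
    (Eventually.of_forall fun x => by fun_prop) (hμ.integrable_bern hx.le) (by fun_prop)
    (ae_of_all _ fun m y hy => ?_) hμ (ae_of_all _ fun m y hy => ?_)).2
  · have := m.2
    rw [Real.norm_of_nonneg (by positivity)]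
    exact mul_le_of_le_one_right m.2.le (exp_neg_mul_le_one (le_of_lt hy) m)
  · have h := (((hasDerivAt_id y).mul_const (m : ℝ)).neg.exp).const_sub 1
    convert! h using 1
    simp; ring

theorem hasDerivAt_lap (hμ : HasMass μ) {x : ℝ} (hx : 0 < x) :
    HasDerivAt (lap μ) (-lapTwo μ x) x := by
  have hx2 : 0 < x / 2 := by positivity
  rw [lapTwo, ← integral_neg]
  refine (hasDerivAt_integral_of_dominated_loc_of_deriv_le (Ioi_mem_nhds (half_lt_self hx))
    (μ := μ)
    (F := fun x (m : MassSpace) => (m : ℝ) * Real.exp (-(x * m)))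
    (bound := fun m : MassSpace => (m : ℝ) ^ 2 * Real.exp (-(x / 2 * m)))
    (F' := fun x (m : MassSpace) => -((m : ℝ) ^ 2 * Real.exp (-(x * m))))
    (Eventually.of_forall fun x => by fun_prop) (hμ.integrable_lap hx.le) (by fun_prop)
    (ae_of_all _ fun m y hy => ?_) (hμ.integrable_lapTwo hx2) (ae_of_all _ fun m y hy => ?_)).2
  · have := m.2
    rw [norm_neg, Real.norm_of_nonneg (by positivity)]
    have hy' : x / 2 < y := hy
    exact mul_le_mul_of_nonneg_left (Real.exp_le_exp.2 (by nlinarith)) (by positivity)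
  · have h := (((hasDerivAt_id y).mul_const (m : ℝ)).neg.exp).const_mul (m : ℝ)
    convert! h using 1
    simp; ring

theorem lapTwo_pos (hμ : HasMass μ) (h0 : μ ≠ 0) {x : ℝ} (hx : 0 < x) : 0 < lapTwo μ x :=
  integral_pos_of_pos h0 (hμ.integrable_lapTwo hx) fun m =>
    mul_pos (pow_pos m.2 2) (Real.exp_pos _)

/-- The inequality 1 + u ≤ e^u, integrated. Used in both directions between two points, it replaces
differentiation in the Legendre argument. -/
theorem bern_le_tangent (hμ : HasMass μ) {x y : ℝ} (hx : 0 ≤ x) (hy : 0 ≤ y) :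
    bern μ y ≤ bern μ x + lap μ x * (y - x) := by
  rw [bern, bern, lap, mul_comm, ← integral_const_mul, ← integral_add (hμ.integrable_bern hx)
    ((hμ.integrable_lap hx).const_mul _)]
  refine integral_mono (hμ.integrable_bern hy) ((hμ.integrable_bern hx).add
    ((hμ.integrable_lap hx).const_mul _)) fun m => ?_
  have h1 : Real.exp (-(y * m)) = Real.exp (-(x * m)) * Real.exp (-((y - x) * m)) := by
    rw [← Real.exp_add]; ring_nf
  have h2 := Real.add_one_le_exp (-((y - x) * m))
  have h3 := mul_le_mul_of_nonneg_left h2 (Real.exp_pos (-(x * m))).le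
  simp only
  rw [h1]; nlinarith

theorem convexOn_lap (hμ : HasMass μ) : ConvexOn ℝ (Ici 0) (lap μ) := by
  refine ⟨convex_Ici 0, fun x hx y hy a b ha hb hab => ?_⟩
  have hx' : (0 : ℝ) ≤ x := hx
  have hy' : (0 : ℝ) ≤ y := hy
  have hz : 0 ≤ a • x + b • y := by simp only [smul_eq_mul]; positivity
  simp only [lap, smul_eq_mul] at hz ⊢
  rw [← integral_const_mul, ← integral_const_mul, ← integral_add
    ((hμ.integrable_lap hx).const_mul _) ((hμ.integrable_lap hy).const_mul _)]
  refine integral_mono (hμ.integrable_lap hz) (((hμ.integrable_lap hx).const_mul _).add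
    ((hμ.integrable_lap hy).const_mul _)) fun m => ?_
  have h := convexOn_exp.2 (mem_univ (-(x * m))) (mem_univ (-(y * m))) ha hb hab
  simp only [smul_eq_mul] at h
  have h' := mul_le_mul_of_nonneg_left h m.2.le
  calc (m : ℝ) * Real.exp (-((a * x + b * y) * m))
      = m * Real.exp (a * -(x * m) + b * -(y * m)) := by ring_nf
    _ ≤ _ := h'
    _ = _ := by ring

end HasMass

/-! ### Uniqueness of the measure with a given transform -/

/-- A measure with finite first moment is determined by the transform `lap`. -/
theorem eq_of_lap_eq {μ ν : Measure MassSpace} (hμ : HasMass μ) (hν : HasMass ν)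
    (h : ∀ x, 0 < x → lap μ x = lap ν x) : μ = ν := by
  have hopen : IsOpen {m : ℝ | 0 < m} := isOpen_Ioi
  have : PolishSpace MassSpace := hopen.polishSpace
  -- Weighting by m e^{-m} makes the measure finite, and its integrals against powers of e^{-m} are
  -- the values of `lap` at positive integers. Polynomials in the injective function e^{-m} separate
  -- points, so these values suffice.
  let e : BoundedContinuousFunction MassSpace ℝ := BoundedContinuousFunction.ofNormedAddCommGroup
    (fun m : MassSpace => Real.exp (-(m : ℝ))) (by fun_prop) 1 fun m => by
      rw [Real.norm_of_nonneg (Real.exp_pos _).le]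
      simpa using exp_neg_mul_le_one zero_le_one m
  let d : MassSpace → ℝ≥0∞ := fun m => ENNReal.ofReal ((m : ℝ) * Real.exp (-(m : ℝ)))
  have hd : Measurable d := by fun_prop
  have hd0 : ∀ m, d m ≠ 0 := fun m => by
    simp only [d, ne_eq, ENNReal.ofReal_eq_zero, not_le]
    exact mul_pos m.2 (Real.exp_pos _)
  have hfin : ∀ {ρ : Measure MassSpace}, HasMass ρ → IsFiniteMeasure (ρ.withDensity d) := by
    intro ρ hρ
    refine isFiniteMeasure_withDensity_ofReal ?_
    simpa using (hρ.integrable_lap zero_le_one).2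
  have hint : ∀ {ρ : Measure MassSpace}, HasMass ρ → ∀ n : ℕ,
      ∫ m, (e ^ n) m ∂(ρ.withDensity d) = lap ρ (n + 1) := by
    intro ρ hρ n
    rw [integral_withDensity_eq_integral_toReal_smul hd (ae_of_all _ fun m => ENNReal.ofReal_lt_top)]
    refine integral_congr_ae (ae_of_all _ fun m => ?_)
    have := m.2
    simp only [d, e, BoundedContinuousFunction.coe_pow, Pi.pow_apply, smul_eq_mul,
      BoundedContinuousFunction.coe_ofNormedAddCommGroup]
    rw [ENNReal.toReal_ofReal (by positivity), ← Real.exp_nat_mul, mul_assoc, ← Real.exp_add]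
    ring_nf
  have := hfin hμ
  have := hfin hν
  have hkey : μ.withDensity d = ν.withDensity d := by
    let A : StarSubalgebra ℝ (BoundedContinuousFunction MassSpace ℝ) :=
      { (Polynomial.aeval (R := ℝ) e).range with
        star_mem' := fun {a} ha => by
          have : star a = a := by ext; simp
          rw [this]; exact ha }
    refine ext_of_forall_mem_subalgebra_integral_eq_of_polish (𝕜 := ℝ) (A := A) ?_ ?_
    · intro x y hxy
      refine ⟨e, ⟨_, ⟨e, ⟨Polynomial.X, by simp⟩, rfl⟩, rfl⟩, ?_⟩
      intro hexp
      apply hxy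
      have : Real.exp (-(x : ℝ)) = Real.exp (-(y : ℝ)) := hexp
      exact Subtype.ext (neg_injective (Real.exp_injective this))
    · rintro g ⟨p, rfl⟩
      have hpoly : ∀ {ρ : Measure MassSpace}, HasMass ρ →
          ∫ m, (Polynomial.aeval (R := ℝ) e p) m ∂(ρ.withDensity d) =
            ∑ n ∈ Finset.range (p.natDegree + 1), p.coeff n * lap ρ (n + 1) := by
        intro ρ hρ
        have := hfin hρ
        have : ∀ m, (Polynomial.aeval (R := ℝ) e p) m =
            ∑ n ∈ Finset.range (p.natDegree + 1), p.coeff n * (e ^ n) m := fun m => by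
          rw [Polynomial.aeval_eq_sum_range]
          simp
        simp_rw [this]
        rw [integral_finsetSum]
        · refine Finset.sum_congr rfl fun n _ => ?_
          rw [integral_const_mul, hint hρ]
        · intro n _
          exact ((e ^ n).integrable _).const_mul _
      change ∫ m, (Polynomial.aeval (R := ℝ) e p) m ∂_ = ∫ m, (Polynomial.aeval (R := ℝ) e p) m ∂_
      rw [hpoly hμ, hpoly hν]
      refine Finset.sum_congr rfl fun n _ => ?_
      rw [h _ (by positivity)]
  -- The density is positive and finite everywhere, so it can be divided out.
  have hinv : ∀ ρ : Measure MassSpace, (ρ.withDensity d).withDensity (fun m => (d m)⁻¹) = ρ := by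
    intro ρ
    exact withDensity_inv_same₀ hd.aemeasurable (ae_of_all _ hd0)
      (ae_of_all _ fun m => ENNReal.ofReal_ne_top)
  rw [← hinv μ, hkey, hinv ν]

/-! ### Cutoff functions -/

/-- Continuous cutoff functions with compact support in `(0, ∞)`, increasing to `1`. -/
def cutoff (n : ℕ) (m : MassSpace) : ℝ := max 0 (min 1 (min (n * (m : ℝ) - 1) (n - (m : ℝ))))

theorem continuous_cutoff (n : ℕ) : Continuous (cutoff n) := by
  unfold cutoff; fun_prop

theorem cutoff_nonneg (n : ℕ) (m : MassSpace) : 0 ≤ cutoff n m := le_max_left _ _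

theorem cutoff_le_one (n : ℕ) (m : MassSpace) : cutoff n m ≤ 1 :=
  max_le zero_le_one (min_le_left _ _)

theorem monotone_cutoff (m : MassSpace) : Monotone fun n => cutoff n m := by
  intro a b hab
  have h : (a : ℝ) ≤ b := by exact_mod_cast hab
  have := m.2
  have h2 : (a : ℝ) * m ≤ b * m := mul_le_mul_of_nonneg_right h m.2.le
  exact max_le_max_left _ (min_le_min_left _ (min_le_min (by linarith) (by linarith)))

theorem tendsto_cutoff (m : MassSpace) : Tendsto (fun n => cutoff n m) atTop (𝓝 1) := by
  refine tendsto_const_nhds.congr' ?_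
  have h1 : Tendsto (fun n : ℕ => (n : ℝ) * m) atTop atTop :=
    tendsto_natCast_atTop_atTop.atTop_mul_const m.2
  filter_upwards [h1.eventually_ge_atTop 2,
    (tendsto_natCast_atTop_atTop (R := ℝ)).eventually_ge_atTop ((m : ℝ) + 1)] with n hn hn'
  rw [cutoff, min_eq_left (le_min (by linarith) (by linarith)), max_eq_right zero_le_one]

theorem hasCompactSupport_cutoff (n : ℕ) : HasCompactSupport (cutoff n) := by
  refine HasCompactSupport.intro
    (K := (Subtype.val : MassSpace → ℝ) ⁻¹' Icc (1 / ((n : ℝ) + 1)) n) ?_ fun m hm => ?_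
  · rw [Subtype.isCompact_iff, image_preimage_eq_of_subset]
    · exact isCompact_Icc
    · intro x hx
      have : 0 < 1 / ((n : ℝ) + 1) := by positivity
      exact ⟨⟨x, this.trans_le hx.1⟩, rfl⟩
  · rw [cutoff, max_eq_left]
    by_contra hcon
    push Not at hcon
    have h1 := lt_of_lt_of_le hcon ((min_le_right _ _).trans (min_le_left _ _))
    have h2 := lt_of_lt_of_le hcon ((min_le_right _ _).trans (min_le_right _ _))
    refine hm ⟨?_, by linarith⟩
    have := m.2
    rw [div_le_iff₀ (by positivity)]
    nlinarith

theorem tendsto_lintegral_mul_cutoff (μ : Measure MassSpace) {φ : MassSpace → ℝ}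
    (hφ : Continuous φ) (h0 : ∀ m, 0 ≤ φ m) :
    Tendsto (fun n => ∫⁻ m, ENNReal.ofReal (φ m * cutoff n m) ∂μ) atTop
      (𝓝 (∫⁻ m, ENNReal.ofReal (φ m) ∂μ)) := by
  refine lintegral_tendsto_of_tendsto_of_monotone (fun n => ?_) (ae_of_all _ fun m => ?_)
    (ae_of_all _ fun m => ?_)
  · have := continuous_cutoff n
    exact (by fun_prop : Measurable fun m => ENNReal.ofReal (φ m * cutoff n m)).aemeasurable
  · exact fun a b hab => ENNReal.ofReal_le_ofReal
      (mul_le_mul_of_nonneg_left (monotone_cutoff m hab) (h0 m))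
  · have := (tendsto_cutoff m).const_mul (φ m)
    rw [mul_one] at this
    exact (ENNReal.continuous_ofReal.tendsto _).comp this

theorem integrable_mul_cutoff (μ : Measure MassSpace) [IsLocallyFiniteMeasure μ]
    {φ : MassSpace → ℝ} (hφ : Continuous φ) (n : ℕ) :
    Integrable (fun m => φ m * cutoff n m) μ :=
  (hφ.mul (continuous_cutoff n)).integrable_of_hasCompactSupport
    ((hasCompactSupport_cutoff n).mul_left)

theorem lintegral_mul_cutoff (μ : Measure MassSpace) [IsLocallyFiniteMeasure μ]
    {φ : MassSpace → ℝ} (hφ : Continuous φ) (h0 : ∀ m, 0 ≤ φ m) (n : ℕ) :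
    ∫⁻ m, ENNReal.ofReal (φ m * cutoff n m) ∂μ = ENNReal.ofReal (∫ m, φ m * cutoff n m ∂μ) :=
  (ofReal_integral_eq_lintegral_ofReal (integrable_mul_cutoff μ hφ n)
    (ae_of_all _ fun m => mul_nonneg (h0 m) (cutoff_nonneg n m))).symm

/-- The first moment of a family of Radon measures is measurable in time if the family is
vaguely measurable. -/
theorem aemeasurable_firstMoment {μ : ℝ → Measure MassSpace} {t : ℝ}
    (hloc : ∀ s, 0 ≤ s → IsLocallyFiniteMeasure (μ s))
    (hmeas : ∀ φ : MassSpace → ℝ, Continuous φ → HasCompactSupport φ →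
      AEMeasurable (fun s => ∫ m, φ m ∂(μ s)) (volume.restrict (Ioc 0 t))) :
    AEMeasurable (fun s => firstMoment (μ s)) (volume.restrict (Ioc 0 t)) := by
  refine aemeasurable_of_tendsto_metrizable_ae atTop
    (f := fun n s => ENNReal.ofReal (∫ m : MassSpace, (m : ℝ) * cutoff n m ∂(μ s)))
    (fun n => ?_) ?_
  · exact (hmeas _ (continuous_subtype_val.mul (continuous_cutoff n))
      (hasCompactSupport_cutoff n).mul_left).ennreal_ofReal
  · filter_upwards [ae_restrict_mem measurableSet_Ioc] with s hs
    have := hloc s hs.1.le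
    have h := tendsto_lintegral_mul_cutoff (μ s) continuous_subtype_val fun m => m.2.le
    exact h.congr fun n => lintegral_mul_cutoff (μ s) continuous_subtype_val (fun m => m.2.le) n

/-! ### The coagulation term -/

theorem abs_coagDiff_le {φ : MassSpace → ℝ} {C : ℝ} (h : ∀ m, |φ m| ≤ C) (m m' : MassSpace) :
    |coagDiff φ m m'| ≤ 3 * C := by
  have h1 := abs_le.1 (h (m + m'))
  have h2 := abs_le.1 (h m)
  have h3 := abs_le.1 (h m')
  rw [coagDiff, abs_le]
  constructor <;> linarith [h1.1, h1.2, h2.1, h2.2, h3.1, h3.2]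

theorem continuous_coag {φ : MassSpace → ℝ} (hφ : Continuous φ) :
    Continuous fun p : MassSpace × MassSpace => (p.1 : ℝ) * (p.2 : ℝ) * coagDiff φ p.1 p.2 := by
  have hadd : Continuous fun p : MassSpace × MassSpace => p.1 + p.2 :=
    Continuous.subtype_mk (by fun_prop) _
  unfold coagDiff
  fun_prop

theorem norm_coag_le {φ : MassSpace → ℝ} {C : ℝ} (h : ∀ m, |φ m| ≤ C) (p : MassSpace × MassSpace) :
    ‖(p.1 : ℝ) * (p.2 : ℝ) * coagDiff φ p.1 p.2‖ ≤ 3 * C * ((p.1 : ℝ) * (p.2 : ℝ)) := by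
  have h1 := p.1.2
  have h2 := p.2.2
  rw [norm_mul, Real.norm_of_nonneg (by positivity), mul_comm, Real.norm_eq_abs]
  exact mul_le_mul_of_nonneg_right (abs_coagDiff_le h _ _) (by positivity)

theorem coagTerm_nonpos (μ : Measure MassSpace) {φ : MassSpace → ℝ}
    (h : ∀ m m', coagDiff φ m m' ≤ 0) : coagTerm μ φ ≤ 0 :=
  integral_nonpos fun p =>
    mul_nonpos_of_nonneg_of_nonpos (mul_nonneg p.1.2.le p.2.2.le) (h _ _)

namespace HasMass

variable {μ : Measure MassSpace}

theorem abs_coagTerm_le [IsLocallyFiniteMeasure μ] (hμ : HasMass μ) {φ : MassSpace → ℝ} {C : ℝ}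
    (h : ∀ m, |φ m| ≤ C) : |coagTerm μ φ| ≤ 3 * C * lap μ 0 ^ 2 := by
  have h1 := norm_integral_le_of_norm_le ((hμ.mul_prod hμ).const_mul (3 * C))
    (ae_of_all _ (norm_coag_le h))
  rw [integral_const_mul, integral_prod_mul (μ := μ) (ν := μ) (fun m : MassSpace => (m : ℝ))
    (fun m : MassSpace => (m : ℝ))] at h1
  rw [lap_zero, pow_two]
  exact h1

theorem tendsto_coagTerm (hμ : HasMass μ) {φ : MassSpace → ℝ} (hφ : Continuous φ) {C : ℝ}
    (h : ∀ m, |φ m| ≤ C) :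
    Tendsto (fun n => coagTerm μ fun m => φ m * cutoff n m) atTop (𝓝 (coagTerm μ φ)) := by
  have hlim : ∀ m, Tendsto (fun n => φ m * cutoff n m) atTop (𝓝 (φ m)) := fun m => by
    simpa using (tendsto_cutoff m).const_mul (φ m)
  refine tendsto_integral_of_dominated_convergence _ (fun n =>
    (continuous_coag (hφ.mul (continuous_cutoff n))).aestronglyMeasurable)
    ((hμ.mul_prod hμ).const_mul (3 * C)) (fun n => ae_of_all _ (norm_coag_le fun m => ?_))
    (ae_of_all _ fun p => ?_)
  · rw [abs_mul, abs_of_nonneg (cutoff_nonneg n m)]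
    exact (mul_le_of_le_one_right (abs_nonneg _) (cutoff_le_one n m)).trans (h m)
  · exact (((hlim _).sub (hlim _)).sub (hlim _)).const_mul _

/-- For this test function Δφ(m, m') = -(1 - e^{-xm})(1 - e^{-xm'}), so the double integral is minus
the square of a single one. This is what closes the equation for the transform. -/
theorem coagTerm_bern [IsLocallyFiniteMeasure μ] (hμ : HasMass μ) {x : ℝ} (hx : 0 ≤ x) :
    coagTerm μ (fun m => 1 - Real.exp (-(x * m))) = -(lap μ 0 - lap μ x) ^ 2 := by
  have h0 : lap μ 0 - lap μ x =
      ∫ m : MassSpace, ((m : ℝ) - (m : ℝ) * Real.exp (-(x * m))) ∂μ := by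
    rw [lap_zero, lap, integral_sub hμ (hμ.integrable_lap hx)]
  rw [h0, pow_two, ← integral_prod_mul (μ := μ) (ν := μ), ← integral_neg, coagTerm]
  refine integral_congr_ae (ae_of_all _ fun p => ?_)
  have : Real.exp (-(x * ((p.1 + p.2 : MassSpace) : ℝ))) =
      Real.exp (-(x * p.1)) * Real.exp (-(x * p.2)) := by
    rw [← Real.exp_add, Positive.coe_add]; ring_nf
  simp only [coagDiff, this]
  ring

end HasMass

/-! ### Weighted solutions -/

/-- Solutions of Smoluchowski's equation run at the variable speed `w`. -/
structure WeightedSolution (w : ℝ → ℝ) (ν : ℝ → Measure MassSpace) : Prop where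
  continuous_weight : Continuous w
  weight_pos : ∀ t, 0 < w t
  radon : ∀ t, 0 ≤ t → IsLocallyFiniteMeasure (ν t)
  hasMass_zero : HasMass (ν 0)
  sq_integrable : ∀ t, 0 < t → ∫⁻ s in Ioc 0 t, firstMoment (ν s) ^ 2 < ∞
  equation : ∀ φ : MassSpace → ℝ, Continuous φ → HasCompactSupport φ → ∀ t, 0 < t →
    IntervalIntegrable (fun s => w s * coagTerm (ν s) φ) volume 0 t ∧
    ∫ m, φ m ∂(ν t) = ∫ m, φ m ∂(ν 0) + 1 / 2 * ∫ s in (0 : ℝ)..t, w s * coagTerm (ν s) φ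

theorem integrableOn_sq_lap_zero {μ : ℝ → Measure MassSpace} {t : ℝ}
    (hM : AEMeasurable (fun s => firstMoment (μ s)) (volume.restrict (Ioc 0 t)))
    (hsq : ∫⁻ s in Ioc 0 t, firstMoment (μ s) ^ 2 < ∞) :
    IntegrableOn (fun s => lap (μ s) 0 ^ 2) (Ioc 0 t) := by
  simp_rw [← toReal_firstMoment]
  refine ⟨(hM.ennreal_toReal.pow_const 2).aestronglyMeasurable, ?_⟩
  refine lt_of_le_of_lt (lintegral_mono fun s => ?_) hsq
  beta_reduce
  rw [← ENNReal.toReal_pow, Real.enorm_of_nonneg ENNReal.toReal_nonneg]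
  exact ENNReal.ofReal_toReal_le

theorem ae_hasMass {μ : ℝ → Measure MassSpace} {t : ℝ}
    (hM : AEMeasurable (fun s => firstMoment (μ s)) (volume.restrict (Ioc 0 t)))
    (hsq : ∫⁻ s in Ioc 0 t, firstMoment (μ s) ^ 2 < ∞) :
    ∀ᵐ s ∂(volume.restrict (Ioc 0 t)), HasMass (μ s) := by
  filter_upwards [ae_lt_top' (hM.pow_const 2) hsq.ne] with s hs
  rw [hasMass_iff]
  by_contra h
  rw [not_lt, top_le_iff] at h
  simp [h] at hs

/-! ### Extension of the equation to noncompact test functions -/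

namespace WeightedSolution

variable {w : ℝ → ℝ} {ν : ℝ → Measure MassSpace}

theorem aemeasurable_firstMoment (h : WeightedSolution w ν) {t : ℝ} (ht : 0 < t) :
    AEMeasurable (fun s => firstMoment (ν s)) (volume.restrict (Ioc 0 t)) := by
  refine Coagulation.aemeasurable_firstMoment h.radon fun φ hφ hc => ?_
  have hI := (h.equation φ hφ hc t ht).1
  have hcont : ContinuousOn (fun s => ∫ m, φ m ∂(ν 0) +
      1 / 2 * ∫ r in (0 : ℝ)..s, w r * coagTerm (ν r) φ) (Icc 0 t) := by
    have := intervalIntegral.continuousOn_primitive_interval' hI left_mem_uIcc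
    rw [uIcc_of_le ht.le] at this
    fun_prop
  refine ((hcont.mono Ioc_subset_Icc_self).aemeasurable measurableSet_Ioc).congr ?_
  filter_upwards [ae_restrict_mem measurableSet_Ioc] with s hs
  exact (h.equation φ hφ hc s hs.1).2.symm

theorem exists_weight_le (h : WeightedSolution w ν) (t : ℝ) :
    ∃ B, 0 < B ∧ ∀ s ∈ Icc 0 t, w s ≤ B := by
  obtain ⟨B, hB⟩ := isCompact_Icc.exists_bound_of_continuousOn
    (h.continuous_weight.continuousOn (s := Icc 0 t))
  refine ⟨max B 1, by positivity, fun s hs => ?_⟩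
  exact (le_abs_self _).trans ((hB s hs).trans (le_max_left _ _))

/-- Dominated convergence twice: in the masses with majorant a multiple of mm', then in time with
majorant a multiple of the squared first moment. -/
theorem tendsto_integral_coagTerm (h : WeightedSolution w ν) {t : ℝ} (ht : 0 < t)
    {φ : MassSpace → ℝ} (hφ : Continuous φ) {C : ℝ} (hC : ∀ m, |φ m| ≤ C) :
    IntervalIntegrable (fun s => w s * coagTerm (ν s) φ) volume 0 t ∧
    Tendsto (fun n => ∫ s in (0 : ℝ)..t, w s * coagTerm (ν s) fun m => φ m * cutoff n m) atTop
      (𝓝 (∫ s in (0 : ℝ)..t, w s * coagTerm (ν s) φ)) := by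
  obtain ⟨B, hB0, hB⟩ := h.exists_weight_le t
  have hM := h.aemeasurable_firstMoment ht
  have hmass := ae_hasMass hM (h.sq_integrable t ht)
  have hsq := integrableOn_sq_lap_zero hM (h.sq_integrable t ht)
  have hC' : ∀ n m, |φ m * cutoff n m| ≤ C := fun n m => by
    rw [abs_mul, abs_of_nonneg (cutoff_nonneg n m)]
    exact (mul_le_of_le_one_right (abs_nonneg _) (cutoff_le_one n m)).trans (hC m)
  have hmeas : ∀ n : ℕ, AEStronglyMeasurable
      (fun s => w s * coagTerm (ν s) fun m => φ m * cutoff n m) (volume.restrict (Ioc 0 t)) := by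
    intro n
    have := (h.equation _ (hφ.mul (continuous_cutoff n))
      (hasCompactSupport_cutoff n).mul_left t ht).1
    exact ((intervalIntegrable_iff_integrableOn_Ioc_of_le ht.le).1 this).1
  have hbd : ∀ ψ : MassSpace → ℝ, (∀ m, |ψ m| ≤ C) → ∀ᵐ s ∂(volume.restrict (Ioc 0 t)),
      ‖w s * coagTerm (ν s) ψ‖ ≤ B * (3 * C * lap (ν s) 0 ^ 2) := by
    intro ψ hψ
    filter_upwards [hmass, ae_restrict_mem measurableSet_Ioc] with s hs hst
    have := h.radon s hst.1.le
    rw [norm_mul, Real.norm_of_nonneg (h.weight_pos s).le]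
    exact mul_le_mul (hB s ⟨hst.1.le, hst.2⟩) (hs.abs_coagTerm_le hψ) (norm_nonneg _) hB0.le
  have hlim : ∀ᵐ s ∂(volume.restrict (Ioc 0 t)),
      Tendsto (fun n => w s * coagTerm (ν s) fun m => φ m * cutoff n m) atTop
        (𝓝 (w s * coagTerm (ν s) φ)) := by
    filter_upwards [hmass, ae_restrict_mem measurableSet_Ioc] with s hs hst
    have := h.radon s hst.1.le
    exact (hs.tendsto_coagTerm hφ hC).const_mul _
  have hBint : IntegrableOn (fun s => B * (3 * C * lap (ν s) 0 ^ 2)) (Ioc 0 t) :=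
    (hsq.const_mul _).const_mul _
  constructor
  · rw [intervalIntegrable_iff_integrableOn_Ioc_of_le ht.le]
    exact Integrable.mono' hBint (aestronglyMeasurable_of_tendsto_ae atTop hmeas hlim) (hbd φ hC)
  · simp_rw [intervalIntegral.integral_of_le ht.le]
    exact tendsto_integral_of_dominated_convergence _ hmeas hBint
      (fun n => hbd _ (hC' n)) hlim

/-- The truncation min(m, K) is subadditive, so its coagulation term is nonpositive. It is bounded
as well, so the cutoffs can be removed; letting K grow then shows that finite mass persists. -/
theorem lintegral_min_le (h : WeightedSolution w ν) {t : ℝ} (ht : 0 < t) (K : ℕ) :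
    ∫⁻ m : MassSpace, ENNReal.ofReal (min (m : ℝ) K) ∂(ν t) ≤ ENNReal.ofReal (lap (ν 0) 0) := by
  have hφ : Continuous fun m : MassSpace => min (m : ℝ) K := by fun_prop
  have h0 : ∀ m : MassSpace, 0 ≤ min (m : ℝ) K := fun m => le_min m.2.le (by positivity)
  have hC : ∀ m : MassSpace, |min (m : ℝ) K| ≤ K := fun m => by
    rw [abs_of_nonneg (h0 m)]; exact min_le_right _ _
  have := h.radon t ht.le
  have := h.radon 0 le_rfl
  have hlim := ((h.tendsto_integral_coagTerm ht hφ hC).2.const_mul (1 / 2)).const_add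
    (lap (ν 0) 0)
  have hnonpos : ∫ s in (0 : ℝ)..t, w s * coagTerm (ν s) (fun m => min (m : ℝ) K) ≤ 0 := by
    rw [intervalIntegral.integral_of_le ht.le]
    refine integral_nonpos fun s => mul_nonpos_of_nonneg_of_nonpos (h.weight_pos s).le
      (coagTerm_nonpos _ fun m m' => ?_)
    have := m.2
    have := m'.2
    simp only [coagDiff, Positive.coe_add]
    rcases le_total (m : ℝ) K with h1 | h1 <;> rcases le_total (m' : ℝ) K with h2 | h2 <;>
      simp only [min_eq_left h1, min_eq_right h1, min_eq_left h2, min_eq_right h2]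
    · linarith [min_le_left ((m : ℝ) + m') (K : ℝ)]
    · linarith [min_le_right ((m : ℝ) + m') (K : ℝ)]
    · linarith [min_le_right ((m : ℝ) + m') (K : ℝ)]
    · linarith [min_le_right ((m : ℝ) + m') (K : ℝ), (Nat.cast_nonneg K : (0 : ℝ) ≤ K)]
  have hlim' := (ENNReal.continuous_ofReal.tendsto _).comp hlim
  refine (le_of_tendsto_of_tendsto' (tendsto_lintegral_mul_cutoff (ν t) hφ h0) hlim'
    fun n => ?_).trans (ENNReal.ofReal_le_ofReal (by linarith))
  have heq := (h.equation _ (hφ.mul (continuous_cutoff n))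
    (hasCompactSupport_cutoff n).mul_left t ht).2
  rw [lintegral_mul_cutoff (ν t) hφ h0]
  refine ENNReal.ofReal_le_ofReal (heq.le.trans (add_le_add ?_ le_rfl))
  rw [lap_zero]
  refine integral_mono (integrable_mul_cutoff _ hφ n) h.hasMass_zero fun m => ?_
  exact (mul_le_of_le_one_right (h0 m) (cutoff_le_one n m)).trans (min_le_left _ _)

theorem hasMass (h : WeightedSolution w ν) {t : ℝ} (ht : 0 ≤ t) : HasMass (ν t) := by
  rcases ht.eq_or_lt with rfl | ht
  · exact h.hasMass_zero
  rw [hasMass_iff]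
  have hlim : Tendsto (fun K : ℕ => ∫⁻ m : MassSpace, ENNReal.ofReal (min (m : ℝ) K) ∂(ν t)) atTop
      (𝓝 (firstMoment (ν t))) := by
    refine lintegral_tendsto_of_tendsto_of_monotone (fun n => by fun_prop)
      (ae_of_all _ fun m a b hab => ?_) (ae_of_all _ fun m => ?_)
    · have : (a : ℝ) ≤ b := by exact_mod_cast hab
      exact ENNReal.ofReal_le_ofReal (min_le_min_left _ this)
    · refine tendsto_const_nhds.congr' ?_
      filter_upwards [(tendsto_natCast_atTop_atTop (R := ℝ)).eventually_ge_atTop (m : ℝ)] with n hn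
      rw [min_eq_left hn]
  exact (le_of_tendsto' hlim fun K => h.lintegral_min_le ht K).trans_lt ENNReal.ofReal_lt_top

/-- The equation holds for all bounded continuous test functions of at most linear growth at `0`. -/
theorem equation_of_bounded (h : WeightedSolution w ν) {t : ℝ} (ht : 0 ≤ t)
    {φ : MassSpace → ℝ} (hφ : Continuous φ) {C : ℝ} (hC : ∀ m, |φ m| ≤ C)
    (hC' : ∀ m : MassSpace, |φ m| ≤ C * m) :
    IntervalIntegrable (fun s => w s * coagTerm (ν s) φ) volume 0 t ∧
    ∫ m, φ m ∂(ν t) = ∫ m, φ m ∂(ν 0) + 1 / 2 * ∫ s in (0 : ℝ)..t, w s * coagTerm (ν s) φ := by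
  rcases ht.eq_or_lt with rfl | ht
  · simp
  obtain ⟨h1, h2⟩ := h.tendsto_integral_coagTerm ht hφ hC
  refine ⟨h1, ?_⟩
  have key : ∀ s, 0 ≤ s → Tendsto (fun n => ∫ m, φ m * cutoff n m ∂(ν s)) atTop
      (𝓝 (∫ m, φ m ∂(ν s))) := by
    intro s hs
    refine tendsto_integral_of_dominated_convergence _
      (fun n => (hφ.mul (continuous_cutoff n)).aestronglyMeasurable)
      ((h.hasMass hs).const_mul C) (fun n => ae_of_all _ fun m => ?_) (ae_of_all _ fun m => ?_)
    · rw [norm_mul, Real.norm_of_nonneg (cutoff_nonneg n m)]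
      exact (mul_le_of_le_one_right (norm_nonneg _) (cutoff_le_one n m)).trans (hC' m)
    · simpa using (tendsto_cutoff m).const_mul (φ m)
  refine tendsto_nhds_unique (key t ht.le) (((key 0 le_rfl).add (h2.const_mul (1 / 2))).congr
    fun n => ?_)
  exact ((h.equation _ (hφ.mul (continuous_cutoff n))
    (hasCompactSupport_cutoff n).mul_left t ht).2).symm

end WeightedSolution

/-! ### Evolution of the transforms and of the Legendre transform -/

/-- Cutting [0, T] into n + 1 equal pieces bounds the total increment by K T²/(n + 1). No
differentiability of G is needed. -/
theorem eq_of_quadratic_increments {G : ℝ → ℝ} {T K : ℝ} (hT : 0 ≤ T)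
    (hG : ∀ s t, 0 ≤ s → s ≤ t → t ≤ T → |G t - G s| ≤ K * (t - s) ^ 2) : G T = G 0 := by
  have key : ∀ n : ℕ, |G T - G 0| ≤ K * T ^ 2 * (1 / ((n : ℝ) + 1)) := by
    intro n
    have hn : (0 : ℝ) < n + 1 := by positivity
    have hsum := Finset.sum_range_sub (fun i : ℕ => G (T * i / (n + 1))) (n + 1)
    have hend : T * ((n + 1 : ℕ) : ℝ) / (n + 1) = T := by push_cast; field_simp
    rw [hend] at hsum
    simp only [Nat.cast_zero, mul_zero, zero_div] at hsum
    rw [← hsum]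
    refine (Finset.abs_sum_le_sum_abs _ _).trans
      ((Finset.sum_le_card_nsmul _ _ (K * (T / (n + 1)) ^ 2) fun i hi => ?_).trans_eq ?_)
    · have hi' : ((i + 1 : ℕ) : ℝ) ≤ n + 1 := by exact_mod_cast Finset.mem_range.1 hi
      have h1 : T * ((i + 1 : ℕ) : ℝ) / (n + 1) - T * i / (n + 1) = T / (n + 1) := by
        push_cast; field_simp; ring
      rw [← h1]
      refine hG _ _ (by positivity) ?_ ?_
      · rw [← sub_nonneg, h1]; positivity
      · rw [div_le_iff₀ hn]; exact mul_le_mul_of_nonneg_left hi' hT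
    · rw [Finset.card_range, nsmul_eq_mul]; push_cast; field_simp
  have hlim := (tendsto_one_div_add_atTop_nhds_zero_nat (𝕜 := ℝ)).const_mul (K * T ^ 2)
  rw [mul_zero] at hlim
  have := ge_of_tendsto' hlim key
  exact sub_eq_zero.1 (abs_eq_zero.1 (le_antisymm this (abs_nonneg _)))

namespace HasMass

variable {μ : Measure MassSpace}

theorem exists_lap_eq (hμ : HasMass μ) {a b p : ℝ} (ha : 0 ≤ a) (hab : a ≤ b)
    (hb : lap μ b ≤ p) (hp : p ≤ lap μ a) : ∃ z ∈ Icc a b, lap μ z = p :=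
  intermediate_value_Icc' hab (hμ.continuousOn_lap.mono fun _ hz => ha.trans hz.1) ⟨hb, hp⟩

theorem exists_lap_eq_of_pos (hμ : HasMass μ) {a p : ℝ} (ha : 0 ≤ a) (hp0 : 0 < p)
    (hp : p ≤ lap μ a) : ∃ z, a ≤ z ∧ lap μ z = p := by
  obtain ⟨b, hb, hab⟩ := ((hμ.tendsto_lap_atTop.eventually (gt_mem_nhds hp0)).and
    (eventually_ge_atTop a)).exists
  obtain ⟨z, hz, hzp⟩ := hμ.exists_lap_eq ha hab hb.le hp
  exact ⟨z, hz.1, hzp⟩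

/-- The Legendre transform depends only on the slope, not on the point chosen to realise it. -/
theorem bern_sub_eq (hμ : HasMass μ) {x y : ℝ} (hx : 0 ≤ x) (hy : 0 ≤ y)
    (h : lap μ x = lap μ y) : bern μ x - lap μ x * x = bern μ y - lap μ y * y := by
  have h1 := hμ.bern_le_tangent hx hy
  have h2 := hμ.bern_le_tangent hy hx
  rw [h] at h1 ⊢
  linarith

end HasMass

namespace WeightedSolution

variable {w : ℝ → ℝ} {ν : ℝ → Measure MassSpace}

theorem integral_sub_integral (h : WeightedSolution w ν) {s t : ℝ} (hs : 0 ≤ s) (hst : s ≤ t)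
    {φ : MassSpace → ℝ} (hφ : Continuous φ) {C : ℝ} (hC : ∀ m, |φ m| ≤ C)
    (hC' : ∀ m : MassSpace, |φ m| ≤ C * m) :
    IntervalIntegrable (fun r => w r * coagTerm (ν r) φ) volume s t ∧
    ∫ m, φ m ∂(ν t) - ∫ m, φ m ∂(ν s) = 1 / 2 * ∫ r in s..t, w r * coagTerm (ν r) φ := by
  obtain ⟨h1, h2⟩ := h.equation_of_bounded (hs.trans hst) hφ hC hC'
  obtain ⟨h3, h4⟩ := h.equation_of_bounded hs hφ hC hC'
  refine ⟨h3.symm.trans h1, ?_⟩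
  rw [h2, h4, ← intervalIntegral.integral_interval_sub_left h1 h3]
  ring

theorem bern_sub (h : WeightedSolution w ν) {s t x : ℝ} (hs : 0 ≤ s) (hst : s ≤ t) (hx : 0 ≤ x) :
    IntervalIntegrable (fun r => w r * (lap (ν r) 0 - lap (ν r) x) ^ 2) volume s t ∧
    bern (ν t) x - bern (ν s) x =
      -(1 / 2 * ∫ r in s..t, w r * (lap (ν r) 0 - lap (ν r) x) ^ 2) := by
  have habs : ∀ m : MassSpace, |1 - Real.exp (-(x * m))| = 1 - Real.exp (-(x * m)) := fun m =>
    abs_of_nonneg (one_sub_exp_nonneg hx m)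
  obtain ⟨h1, h2⟩ := h.integral_sub_integral hs hst
    (φ := fun m : MassSpace => 1 - Real.exp (-(x * m))) (by fun_prop) (C := max 1 x)
    (fun m => by
      rw [habs]
      exact (sub_le_self _ (Real.exp_pos _).le).trans (le_max_left _ _))
    (fun m => by
      rw [habs]
      exact (one_sub_exp_le x m).trans (mul_le_mul_of_nonneg_right (le_max_right _ _) m.2.le))
  have hcongr : EqOn (fun r => w r * coagTerm (ν r) fun m => 1 - Real.exp (-(x * m)))
      (fun r => -(w r * (lap (ν r) 0 - lap (ν r) x) ^ 2)) (uIcc s t) := by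
    intro r hr
    rw [uIcc_of_le hst] at hr
    have := h.radon r (hs.trans hr.1)
    simp only [(h.hasMass (hs.trans hr.1)).coagTerm_bern hx]
    ring
  constructor
  · exact (h1.congr (hcongr.mono uIoc_subset_uIcc)).neg.congr fun r _ => by simp
  · rw [bern, bern, h2, intervalIntegral.integral_congr hcongr, intervalIntegral.integral_neg]
    ring

theorem lap_sub (h : WeightedSolution w ν) {s t x : ℝ} (hs : 0 ≤ s) (hst : s ≤ t) (hx : 0 < x) :
    lap (ν t) x - lap (ν s) x = 1 / 2 * ∫ r in s..t, w r *
      coagTerm (ν r) fun m : MassSpace => (m : ℝ) * Real.exp (-(x * m)) := by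
  have h0 : ∀ m : MassSpace, |(m : ℝ) * Real.exp (-(x * m))| = m * Real.exp (-(x * m)) :=
    fun m => abs_of_nonneg (mul_nonneg m.2.le (Real.exp_pos _).le)
  refine (h.integral_sub_integral hs hst (by fun_prop) (C := max 1 (1 / x)) (fun m => ?_)
    fun m => ?_).2
  · rw [h0]; exact (mul_exp_neg_mul_le hx m).trans (le_max_right _ _)
  · rw [h0, mul_comm]
    exact mul_le_mul_of_nonneg_right ((exp_neg_mul_le_one hx.le m).trans (le_max_left _ _)) m.2.le

/-- The function m e^{-xm} is subadditive for x > 0, so its coagulation term is nonpositive; x = 0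
follows by letting x decrease to 0. -/
theorem lap_le_lap (h : WeightedSolution w ν) {s t x : ℝ} (hs : 0 ≤ s) (hst : s ≤ t)
    (hx : 0 ≤ x) : lap (ν t) x ≤ lap (ν s) x := by
  have hpos : ∀ z ∈ Ioi (0 : ℝ), lap (ν t) z ≤ lap (ν s) z := by
    intro z hz
    rw [← sub_nonpos, h.lap_sub hs hst hz]
    refine mul_nonpos_of_nonneg_of_nonpos (by norm_num) ?_
    rw [intervalIntegral.integral_of_le hst]
    refine integral_nonpos fun r => mul_nonpos_of_nonneg_of_nonpos (h.weight_pos r).le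
      (coagTerm_nonpos _ fun m m' => ?_)
    have h1 := m.2
    have h2 := m'.2
    have h3 : Real.exp (-(z * ((m : ℝ) + m'))) ≤ Real.exp (-(z * m)) :=
      Real.exp_le_exp.2 (by nlinarith [mul_pos hz h2])
    have h4 : Real.exp (-(z * ((m : ℝ) + m'))) ≤ Real.exp (-(z * m')) :=
      Real.exp_le_exp.2 (by nlinarith [mul_pos hz h1])
    simp only [coagDiff, Positive.coe_add]
    nlinarith [mul_le_mul_of_nonneg_left h3 h1.le, mul_le_mul_of_nonneg_left h4 h2.le]
  rcases hx.eq_or_lt with rfl | hx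
  · have hlim : ∀ r, 0 ≤ r → Tendsto (lap (ν r)) (𝓝[>] 0) (𝓝 (lap (ν r) 0)) := fun r hr =>
      ((h.hasMass hr).continuousOn_lap 0 self_mem_Ici).mono_left
        (nhdsWithin_mono _ Ioi_subset_Ici_self)
    exact le_of_tendsto_of_tendsto (hlim t (hs.trans hst)) (hlim s hs)
      (eventually_nhdsWithin_of_forall hpos)
  · exact hpos x hx

theorem lap_le_mass (h : WeightedSolution w ν) {t x : ℝ} (ht : 0 ≤ t) (hx : 0 ≤ x) :
    lap (ν t) x ≤ lap (ν 0) 0 :=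
  (h.lap_le_lap le_rfl ht hx).trans (h.hasMass_zero.lap_anti le_rfl hx)

/-- The bound m e^{-zm} ≤ 1/z ≤ 1/x makes the constant uniform over z ≥ x, as needed when the point
of slope p moves with time. -/
theorem exists_lipschitz (h : WeightedSolution w ν) {x : ℝ} (hx : 0 < x) (T : ℝ) :
    ∃ K, 0 ≤ K ∧ ∀ z, x ≤ z → ∀ s t, 0 ≤ s → s ≤ t → t ≤ T →
      |lap (ν t) z - lap (ν s) z| ≤ K * (t - s) := by
  obtain ⟨B, hB0, hB⟩ := h.exists_weight_le T
  refine ⟨1 / 2 * (B * (3 * (1 / x) * lap (ν 0) 0 ^ 2)), by positivity, ?_⟩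
  intro z hz s t hs hst htT
  have hz0 := hx.trans_le hz
  rw [h.lap_sub hs hst hz0, abs_mul, abs_of_pos (by norm_num : (0 : ℝ) < 1 / 2), mul_assoc]
  refine mul_le_mul_of_nonneg_left ?_ (by norm_num)
  have hbd := intervalIntegral.norm_integral_le_of_norm_le_const (a := s) (b := t)
    (f := fun r => w r * coagTerm (ν r) fun m : MassSpace => (m : ℝ) * Real.exp (-(z * m)))
    (C := B * (3 * (1 / x) * lap (ν 0) 0 ^ 2)) ?_
  · rwa [abs_of_nonneg (sub_nonneg.2 hst)] at hbd
  intro r hr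
  rw [uIoc_of_le hst] at hr
  have hr0 : 0 ≤ r := hs.trans hr.1.le
  have := h.radon r hr0
  rw [norm_mul, Real.norm_of_nonneg (h.weight_pos r).le]
  refine mul_le_mul (hB r ⟨hr0, hr.2.trans htT⟩) ?_ (norm_nonneg _) hB0.le
  refine ((h.hasMass hr0).abs_coagTerm_le (C := 1 / x) fun m => ?_).trans ?_
  · rw [abs_of_nonneg (mul_nonneg m.2.le (Real.exp_pos _).le)]
    exact (mul_exp_neg_mul_le hz0 m).trans (one_div_le_one_div_of_le hx hz)
  · have h1 := h.lap_le_mass hr0 le_rfl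
    have h2 := lap_nonneg (ν r) 0
    gcongr

theorem continuousOn_lap_time (h : WeightedSolution w ν) {x : ℝ} (hx : 0 < x) (T : ℝ) :
    ContinuousOn (fun s => lap (ν s) x) (Icc 0 T) := by
  obtain ⟨K, hK, hL⟩ := h.exists_lipschitz hx T
  refine (LipschitzOnWith.of_dist_le_mul (K := ⟨K, hK⟩) fun s hs t ht => ?_).continuousOn
  rw [Real.dist_eq, Real.dist_eq]
  rcases le_total s t with hst | hst
  · rw [abs_sub_comm, abs_sub_comm s, abs_of_nonneg (sub_nonneg.2 hst)]
    exact hL x le_rfl s t hs.1 hst ht.2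
  · rw [abs_of_nonneg (sub_nonneg.2 hst)]
    exact hL x le_rfl t s ht.1 hst hs.2

theorem antitoneOn_mass (h : WeightedSolution w ν) :
    AntitoneOn (fun s => lap (ν s) 0) (Ici 0) := fun _ hs _ _ hst => h.lap_le_lap hs hst le_rfl

theorem intervalIntegrable_mass (h : WeightedSolution w ν) {s t : ℝ} (hs : 0 ≤ s) (hst : s ≤ t) :
    IntervalIntegrable (fun r => w r * lap (ν r) 0) volume s t := by
  have hsub : uIcc s t ⊆ Ici 0 := by rw [uIcc_of_le hst]; exact fun r hr => hs.trans hr.1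
  exact ((h.antitoneOn_mass.mono hsub).intervalIntegrable).continuousOn_mul
    h.continuous_weight.continuousOn

theorem intervalIntegrable_mass_sq (h : WeightedSolution w ν) {s t : ℝ} (hs : 0 ≤ s)
    (hst : s ≤ t) : IntervalIntegrable (fun r => w r * lap (ν r) 0 ^ 2) volume s t := by
  have hsub : uIcc s t ⊆ Ici 0 := by rw [uIcc_of_le hst]; exact fun r hr => hs.trans hr.1
  have : AntitoneOn (fun r => lap (ν r) 0 ^ 2) (Ici 0) := fun _ hs _ _ hst =>
    pow_le_pow_left₀ (lap_nonneg _ _) (h.lap_le_lap hs hst le_rfl) 2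
  exact ((this.mono hsub).intervalIntegrable).continuousOn_mul
    h.continuous_weight.continuousOn

theorem integral_mass_sub_sq (h : WeightedSolution w ν) {s t : ℝ} (hs : 0 ≤ s) (hst : s ≤ t)
    (p : ℝ) :
    IntervalIntegrable (fun r => w r * (lap (ν r) 0 - p) ^ 2) volume s t ∧
    ∫ r in s..t, w r * (lap (ν r) 0 - p) ^ 2 = (∫ r in s..t, w r * lap (ν r) 0 ^ 2)
      - 2 * p * (∫ r in s..t, w r * lap (ν r) 0) + p ^ 2 * ∫ r in s..t, w r := by
  have h2 := h.intervalIntegrable_mass_sq hs hst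
  have h1 := (h.intervalIntegrable_mass hs hst).const_mul (2 * p)
  have h0 := (h.continuous_weight.intervalIntegrable s t (μ := volume)).const_mul (p ^ 2)
  have heq : (fun r => w r * (lap (ν r) 0 - p) ^ 2) = fun r => w r * lap (ν r) 0 ^ 2
      - 2 * p * (w r * lap (ν r) 0) + p ^ 2 * w r := by ext r; ring
  rw [heq]
  refine ⟨(h2.sub h1).add h0, ?_⟩
  rw [intervalIntegral.integral_add (h2.sub h1) h0, intervalIntegral.integral_sub h2 h1,
    intervalIntegral.integral_const_mul, intervalIntegral.integral_const_mul]

/-- Evolution of the Legendre transform of the Bernstein transform. -/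
theorem legendre (h : WeightedSolution w ν) {t x y : ℝ} (ht : 0 ≤ t) (hx : 0 < x) (hy : 0 < y)
    (hp : 0 < lap (ν t) x) (hxy : lap (ν 0) y = lap (ν t) x) :
    bern (ν 0) y - lap (ν t) x * y = bern (ν t) x - lap (ν t) x * x
      + 1 / 2 * ∫ r in (0 : ℝ)..t, w r * (lap (ν r) 0 - lap (ν t) x) ^ 2 := by
  obtain ⟨B, hB0, hB⟩ := h.exists_weight_le t
  obtain ⟨K, hK0, hK⟩ := h.exists_lipschitz hx t
  set p := lap (ν t) x with hpdef
  set M := lap (ν 0) 0 with hM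
  -- At each time s the slope p is realised at some point X s ≥ x, because the transform decreases
  -- in time and tends to 0 at infinity.
  have hex : ∀ s, ∃ z, s ∈ Icc 0 t → x ≤ z ∧ lap (ν s) z = p := by
    intro s
    by_cases hs : s ∈ Icc 0 t
    · obtain ⟨z, hz⟩ := (h.hasMass hs.1).exists_lap_eq_of_pos hx.le hp
        (h.lap_le_lap hs.1 hs.2 hx.le)
      exact ⟨z, fun _ => hz⟩
    · exact ⟨0, fun h => absurd h hs⟩
  choose X hX using hex
  -- Replacing the fixed slope p by the slope at a fixed point z costs only O((s' - s)²): the slope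
  -- at z equals p at some time in the interval and is Lipschitz in time, and integration supplies
  -- the second factor.
  have hclose : ∀ s s' σ z, 0 ≤ s → s ≤ s' → s' ≤ t → σ ∈ Icc s s' → x ≤ z → lap (ν σ) z = p →
      |(∫ r in s..s', w r * (lap (ν r) 0 - p) ^ 2) -
        ∫ r in s..s', w r * (lap (ν r) 0 - lap (ν r) z) ^ 2| ≤ B * (K * (2 * M)) * (s' - s) ^ 2 := by
    intro s s' σ z hs hss hst hσ hz hσp
    have hz0 : 0 ≤ z := hx.le.trans hz
    rw [← intervalIntegral.integral_sub (h.integral_mass_sub_sq hs hss p).1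
      (h.bern_sub hs hss hz0).1]
    have hbd := intervalIntegral.norm_integral_le_of_norm_le_const (a := s) (b := s')
      (f := fun r => w r * (lap (ν r) 0 - p) ^ 2 - w r * (lap (ν r) 0 - lap (ν r) z) ^ 2)
      (C := B * (K * (s' - s) * (2 * M))) ?_
    · rw [abs_of_nonneg (sub_nonneg.2 hss), Real.norm_eq_abs] at hbd
      exact hbd.trans_eq (by ring)
    intro r hr
    rw [uIoc_of_le hss] at hr
    have hr0 : 0 ≤ r := hs.trans hr.1.le
    have hfac : w r * (lap (ν r) 0 - p) ^ 2 - w r * (lap (ν r) 0 - lap (ν r) z) ^ 2 =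
        w r * ((lap (ν r) z - p) * (2 * lap (ν r) 0 - p - lap (ν r) z)) := by ring
    rw [hfac, norm_mul, norm_mul, Real.norm_of_nonneg (h.weight_pos r).le]
    have hlip : ‖lap (ν r) z - p‖ ≤ K * (s' - s) := by
      rw [Real.norm_eq_abs, ← hσp]
      rcases le_total r σ with hrσ | hrσ
      · rw [abs_sub_comm]
        exact (hK z hz r σ hr0 hrσ (hσ.2.trans hst)).trans
          (mul_le_mul_of_nonneg_left (by linarith [hr.1, hσ.2]) hK0)
      · exact (hK z hz σ r (hs.trans hσ.1) hrσ (hr.2.trans hst)).trans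
          (mul_le_mul_of_nonneg_left (by linarith [hr.2, hσ.1]) hK0)
    have h1 := h.lap_le_mass hr0 le_rfl
    have h2 := h.lap_le_mass hr0 hz0
    have h3 := lap_nonneg (ν r) 0
    have h4 := lap_nonneg (ν r) z
    have h5 : p ≤ M := h.lap_le_mass ht hx.le
    have hM2 : ‖2 * lap (ν r) 0 - p - lap (ν r) z‖ ≤ 2 * M := by
      rw [Real.norm_eq_abs, abs_le]; constructor <;> linarith
    have hss' : 0 ≤ s' - s := sub_nonneg.2 hss
    exact mul_le_mul (hB r ⟨hr0, hr.2.trans hst⟩)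
      (mul_le_mul hlip hM2 (norm_nonneg _) (by positivity)) (by positivity) hB0.le
  have hconst := eq_of_quadratic_increments (T := t) (K := B * (K * (2 * M)))
    (G := fun s => bern (ν s) (X s) - p * X s
      + 1 / 2 * ∫ r in (0 : ℝ)..s, w r * (lap (ν r) 0 - p) ^ 2) ht ?_
  · have h0 := (hX 0 ⟨le_rfl, ht⟩)
    have h1 := (hX t ⟨ht, le_rfl⟩)
    have e0 := h.hasMass_zero.bern_sub_eq (hx.le.trans h0.1) hy.le (h0.2.trans hxy.symm)
    have e1 := (h.hasMass ht).bern_sub_eq (hx.le.trans h1.1) hx.le h1.2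
    rw [h0.2, hxy] at e0
    rw [h1.2] at e1
    simp only [intervalIntegral.integral_same, mul_zero, add_zero] at hconst
    linarith
  intro s s' hs hss hst
  have hs' := hs.trans hss
  obtain ⟨a1, a2⟩ := hX s ⟨hs, hss.trans hst⟩
  obtain ⟨b1, b2⟩ := hX s' ⟨hs', hst⟩
  have c1 := hclose s s' s (X s) hs hss hst ⟨le_rfl, hss⟩ a1 a2
  have c2 := hclose s s' s' (X s') hs hss hst ⟨hss, le_rfl⟩ b1 b2
  have d1 := (h.bern_sub hs hss (hx.le.trans a1)).2
  have d2 := (h.bern_sub hs hss (hx.le.trans b1)).2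
  -- Tangent inequalities at either end compare the moving point with a fixed one and bound the
  -- increment from below and above.
  have e1 := (h.hasMass hs').bern_le_tangent (hx.le.trans b1) (hx.le.trans a1)
  have e2 := (h.hasMass hs).bern_le_tangent (hx.le.trans a1) (hx.le.trans b1)
  have f := intervalIntegral.integral_interval_sub_left (h.integral_mass_sub_sq le_rfl hs' p).1
    (h.integral_mass_sub_sq le_rfl hs p).1
  rw [b2] at e1
  rw [a2] at e2
  rw [abs_le] at c1 c2 ⊢
  have hK' : 0 ≤ B * (K * (2 * M)) * (s' - s) ^ 2 := by
    have := lap_nonneg (ν 0) 0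
    positivity
  constructor <;> linarith [c1.1, c1.2, c2.1, c2.2]

/-! ### The implicit equation and the variational formula for the mass integral -/

/-- An envelope argument. By `legendre` and the tangent inequality at time t, an explicit function
of z is bounded below by φ_t(x), with equality at the point y where g_0(y) = g_t(x). Its derivative
at y vanishes, and the factor g_0'(y) ≠ 0 cancels. -/
theorem characteristic_of_pos (h : WeightedSolution w ν) {t x : ℝ} (ht : 0 ≤ t) (hx : 0 < x)
    (hp : 0 < lap (ν t) x) :
    lap (ν 0) (x + (∫ r in (0 : ℝ)..t, w r * lap (ν r) 0)
      - (∫ r in (0 : ℝ)..t, w r) * lap (ν t) x) = lap (ν t) x := by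
  obtain ⟨y, hxy, hy⟩ := h.hasMass_zero.exists_lap_eq_of_pos hx.le hp
    (h.lap_le_lap le_rfl ht hx.le)
  have hy0 : 0 < y := hx.trans_le hxy
  have hmt := h.hasMass ht
  have hνt : ν t ≠ 0 := by
    intro h0
    rw [h0, lap_zero_measure] at hp
    exact lt_irrefl _ hp
  have hν0 : ν 0 ≠ 0 := by
    intro h0
    rw [← hy, h0, lap_zero_measure] at hp
    exact lt_irrefl _ hp
  set A := ∫ r in (0 : ℝ)..t, w r * lap (ν r) 0
  set W := ∫ r in (0 : ℝ)..t, w r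
  set S := ∫ r in (0 : ℝ)..t, w r * lap (ν r) 0 ^ 2
  have hQ : ∀ p, ∫ r in (0 : ℝ)..t, w r * (lap (ν r) 0 - p) ^ 2 = S - 2 * p * A + p ^ 2 * W :=
    fun p => (h.integral_mass_sub_sq le_rfl ht p).2
  have hder := h.hasMass_zero.hasDerivAt_lap hy0
  have hmin : IsLocalMin (fun z => bern (ν 0) z - lap (ν 0) z * (z - x)
      - 1 / 2 * (S - 2 * lap (ν 0) z * A + lap (ν 0) z ^ 2 * W)) y := by
    have hx2 : (0 : ℝ) < x / 2 := by positivity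
    -- The points x/2 and x + 1 bracket x, so every slope near p is realised at time t by a positive
    -- point.
    have n1 : ∀ᶠ z in 𝓝 y, lap (ν t) (x + 1) < lap (ν 0) z :=
      hder.continuousAt.eventually_const_lt (by
        rw [hy]; exact hmt.lap_strictAnti hνt hx.le (by linarith))
    have n2 : ∀ᶠ z in 𝓝 y, lap (ν 0) z < lap (ν t) (x / 2) :=
      hder.continuousAt.eventually_lt_const (by
        rw [hy]; exact hmt.lap_strictAnti hνt hx2.le (by linarith))
    filter_upwards [n1, n2, lt_mem_nhds hy0] with z hz1 hz2 hz0
    obtain ⟨x', hx', hx'z⟩ := hmt.exists_lap_eq hx2.le (by linarith) hz1.le hz2.le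
    have hx'0 : 0 < x' := hx2.trans_le hx'.1
    have l1 := h.legendre ht hx'0 hz0 (by
      rw [hx'z]; exact h.hasMass_zero.lap_pos hν0 hz0.le) hx'z.symm
    have l2 := h.legendre ht hx hy0 hp hy
    have l3 := hmt.bern_le_tangent hx'0.le hx.le
    rw [hQ, hx'z] at l1
    rw [hQ] at l2
    rw [hx'z] at l3
    rw [hy]
    linarith
  have hd := ((h.hasMass_zero.hasDerivAt_bern hy0).sub
    (hder.mul ((hasDerivAt_id y).sub_const x))).sub
    ((((hder.const_mul 2).mul_const A).const_sub S).add ((hder.pow 2).mul_const W) |>.const_mul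
      (1 / 2))
  have hz := hmin.hasDerivAt_eq_zero hd
  have hpos := h.hasMass_zero.lapTwo_pos hν0 hy0
  have hfac : lapTwo (ν 0) y * (y - (x + A - W * lap (ν t) x)) = 0 := by
    rw [hy] at hz
    simp only [id_eq, Nat.cast_ofNat, Nat.add_one_sub_one, pow_one] at hz
    linear_combination hz
  have := (mul_eq_zero.1 hfac).resolve_left hpos.ne'
  rw [← sub_eq_zero.1 this, hy]

theorem weight_mul_mass_le (h : WeightedSolution w ν) {t : ℝ} (ht : 0 ≤ t) :
    (∫ r in (0 : ℝ)..t, w r) * lap (ν t) 0 ≤ ∫ r in (0 : ℝ)..t, w r * lap (ν r) 0 := by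
  rw [← intervalIntegral.integral_mul_const]
  refine intervalIntegral.integral_mono_on ht
    ((h.continuous_weight.mul continuous_const).intervalIntegrable _ _)
    (h.intervalIntegrable_mass le_rfl ht) fun r hr => ?_
  exact mul_le_mul_of_nonneg_left (h.lap_le_lap hr.1 hr.2 le_rfl) (h.weight_pos r).le

theorem weight_integral_nonneg (h : WeightedSolution w ν) {t : ℝ} (ht : 0 ≤ t) :
    0 ≤ ∫ r in (0 : ℝ)..t, w r :=
  intervalIntegral.integral_nonneg ht fun r _ => (h.weight_pos r).le

theorem weight_mul_lap_le (h : WeightedSolution w ν) {t x : ℝ} (ht : 0 ≤ t) (hx : 0 ≤ x) :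
    (∫ r in (0 : ℝ)..t, w r) * lap (ν t) x ≤ ∫ r in (0 : ℝ)..t, w r * lap (ν r) 0 :=
  (mul_le_mul_of_nonneg_left ((h.hasMass ht).lap_anti le_rfl hx)
    (h.weight_integral_nonneg ht)).trans (h.weight_mul_mass_le ht)

theorem mass_integral_mono (h : WeightedSolution w ν) {s t : ℝ} (hs : 0 ≤ s) (hst : s ≤ t) :
    ∫ r in (0 : ℝ)..s, w r * lap (ν r) 0 ≤ ∫ r in (0 : ℝ)..t, w r * lap (ν r) 0 := by
  have := intervalIntegral.integral_interval_sub_left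
    (h.intervalIntegrable_mass le_rfl (hs.trans hst)) (h.intervalIntegrable_mass le_rfl hs)
  have h2 : 0 ≤ ∫ r in s..t, w r * lap (ν r) 0 :=
    intervalIntegral.integral_nonneg hst fun r _ =>
      mul_nonneg (h.weight_pos r).le (lap_nonneg _ _)
  linarith

/-- Wherever the transform at x is positive before time t, the implicit equation bounds it below by
the fixed c > 0. Being continuous in time and initially at least c, it cannot cross c/2 to reach 0.
-/
theorem lap_pos (h : WeightedSolution w ν) (h0 : ν 0 ≠ 0) {t x : ℝ} (ht : 0 ≤ t) (hx : 0 < x) :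
    0 < lap (ν t) x := by
  set A := ∫ r in (0 : ℝ)..t, w r * lap (ν r) 0 with hA
  have hA0 : 0 ≤ A := by
    have := h.weight_mul_lap_le ht hx.le
    exact (mul_nonneg (h.weight_integral_nonneg ht) (lap_nonneg _ _)).trans this
  set c := lap (ν 0) (x + A) with hc
  have hcpos : 0 < c := h.hasMass_zero.lap_pos h0 (by positivity)
  have hgap : ∀ s ∈ Icc 0 t, 0 < lap (ν s) x → c ≤ lap (ν s) x := by
    intro s hs hpos
    rw [← h.characteristic_of_pos hs.1 hx hpos]
    have h1 := h.weight_mul_lap_le hs.1 hx.le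
    have h2 := h.mass_integral_mono hs.1 hs.2
    have h3 := mul_nonneg (h.weight_integral_nonneg hs.1) (lap_nonneg (ν s) x)
    exact h.hasMass_zero.lap_anti (by linarith) (by linarith)
  by_contra hcon
  have hzero : lap (ν t) x = 0 := le_antisymm (not_lt.1 hcon) (lap_nonneg _ _)
  have hc0 : c ≤ lap (ν 0) x := h.hasMass_zero.lap_anti hx.le (by linarith)
  obtain ⟨s, hs, hsc⟩ := intermediate_value_Icc' ht (h.continuousOn_lap_time hx t)
    (show c / 2 ∈ Icc (lap (ν t) x) (lap (ν 0) x) from ⟨by rw [hzero]; positivity, by linarith⟩)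
  have hsc' : lap (ν s) x = c / 2 := hsc
  have := hgap s hs (by rw [hsc']; positivity)
  linarith

/-- The implicit equation satisfied by the transform of a solution. -/
theorem characteristic (h : WeightedSolution w ν) {t x : ℝ} (ht : 0 ≤ t) (hx : 0 ≤ x) :
    lap (ν 0) (x + (∫ r in (0 : ℝ)..t, w r * lap (ν r) 0)
      - (∫ r in (0 : ℝ)..t, w r) * lap (ν t) x) = lap (ν t) x := by
  have hpos : EqOn (fun x => lap (ν 0) (x + (∫ r in (0 : ℝ)..t, w r * lap (ν r) 0)
      - (∫ r in (0 : ℝ)..t, w r) * lap (ν t) x)) (lap (ν t)) (Ioi 0) := by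
    intro z hz
    have hz' : 0 < z := hz
    by_cases h0 : ν 0 = 0
    · have h1 := h.lap_le_lap le_rfl ht hz'.le
      rw [h0, lap_zero_measure] at h1
      simp only [h0, lap_zero_measure]
      exact le_antisymm (lap_nonneg _ _) h1
    · exact h.characteristic_of_pos ht hz' (h.lap_pos h0 ht hz')
  have hc := (h.hasMass ht).continuousOn_lap
  refine hpos.of_subset_closure (t := Ici 0) ?_ hc Ioi_subset_Ici_self (by simp) hx
  refine h.hasMass_zero.continuousOn_lap.comp (by fun_prop) fun z hz => ?_
  have hz' : 0 ≤ z := hz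
  have := h.weight_mul_lap_le ht hz'
  simp only [mem_Ici]
  linarith

/-- The point at which the initial transform takes the value of the current mass. -/
theorem lap_gel_point (h : WeightedSolution w ν) {t : ℝ} (ht : 0 ≤ t) :
    lap (ν 0) ((∫ r in (0 : ℝ)..t, w r * lap (ν r) 0)
      - (∫ r in (0 : ℝ)..t, w r) * lap (ν t) 0) = lap (ν t) 0 := by
  simpa using h.characteristic ht le_rfl

/-- The map x ↦ x + A - W g_t(x) starts at the gel point and reaches y at some x ≥ 0. There the
implicit equation reads A = y + W g_0(y) - x. -/
theorem mass_integral_le_of_gel_point_le (h : WeightedSolution w ν) {t y : ℝ} (ht : 0 ≤ t)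
    (hy : (∫ r in (0 : ℝ)..t, w r * lap (ν r) 0) - (∫ r in (0 : ℝ)..t, w r) * lap (ν t) 0 ≤ y) :
    ∫ r in (0 : ℝ)..t, w r * lap (ν r) 0 ≤ y + (∫ r in (0 : ℝ)..t, w r) * lap (ν 0) y := by
  have hch := fun x (hx : 0 ≤ x) => h.characteristic ht hx
  have hW := h.weight_integral_nonneg ht
  set A := ∫ r in (0 : ℝ)..t, w r * lap (ν r) 0
  set W := ∫ r in (0 : ℝ)..t, w r
  set X := y - (A - W * lap (ν t) 0) with hX
  have hX0 : 0 ≤ X := sub_nonneg.2 hy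
  have hcont : ContinuousOn (fun x => x + A - W * lap (ν t) x) (Icc 0 X) := by
    have := (h.hasMass ht).continuousOn_lap.mono fun z (hz : z ∈ Icc 0 X) => hz.1
    fun_prop
  have hlap := mul_le_mul_of_nonneg_left ((h.hasMass ht).lap_anti le_rfl hX0) hW
  obtain ⟨x, hx, hxy⟩ := intermediate_value_Icc hX0 hcont
    (show y ∈ Icc _ _ from ⟨by simpa using hy, by linarith⟩)
  have hxy' : x + A - W * lap (ν t) x = y := hxy
  have := hch x hx.1
  rw [hxy'] at this
  rw [this]
  linarith [hx.1]

/-- Let s be the last time at which the inequality holds. Later the gel point must exceed y, so the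
mass is at most g_0(y) and the difference κ cannot increase; hence κ(t) ≤ κ(s) ≤ 0. -/
theorem mass_integral_le (h : WeightedSolution w ν) {t y : ℝ} (ht : 0 ≤ t) (hy : 0 ≤ y) :
    ∫ r in (0 : ℝ)..t, w r * lap (ν r) 0 ≤ y + (∫ r in (0 : ℝ)..t, w r) * lap (ν 0) y := by
  set κ : ℝ → ℝ := fun r => (∫ u in (0 : ℝ)..r, w u * lap (ν u) 0)
    - (y + (∫ u in (0 : ℝ)..r, w u) * lap (ν 0) y) with hκ
  have hwI : ∀ a b, IntervalIntegrable w volume a b := fun a b =>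
    h.continuous_weight.intervalIntegrable a b
  have hcont : ContinuousOn κ (Icc 0 t) := by
    have h1 := intervalIntegral.continuousOn_primitive_interval'
      (h.intervalIntegrable_mass le_rfl ht) left_mem_uIcc
    have h2 := intervalIntegral.continuousOn_primitive_interval' (hwI 0 t) left_mem_uIcc
    rw [uIcc_of_le ht] at h1 h2
    fun_prop
  have hcomp : IsCompact (Icc 0 t ∩ κ ⁻¹' Iic 0) :=
    isCompact_Icc.of_isClosed_subset (hcont.preimage_isClosed_of_isClosed isClosed_Icc isClosed_Iic)
      inter_subset_left
  have hne : (Icc 0 t ∩ κ ⁻¹' Iic 0).Nonempty := ⟨0, ⟨le_rfl, ht⟩, by simpa [hκ] using hy⟩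
  have hs := hcomp.sSup_mem hne
  set s := sSup (Icc 0 t ∩ κ ⁻¹' Iic 0) with hsdef
  have hafter : ∀ r ∈ Ioc s t, lap (ν r) 0 ≤ lap (ν 0) y := by
    intro r hr
    have hr0 : 0 ≤ r := hs.1.1.trans hr.1.le
    have hpos : 0 < κ r := by
      by_contra hcon
      exact absurd (le_csSup hcomp.bddAbove ⟨⟨hr0, hr.2⟩, not_lt.1 hcon⟩) (not_le.2 hr.1)
    rw [← h.lap_gel_point hr0]
    refine h.hasMass_zero.lap_anti hy ?_
    by_contra hcon
    have := h.mass_integral_le_of_gel_point_le hr0 (not_le.1 hcon).le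
    simp only [hκ] at hpos
    linarith
  have hst := hs.1.2
  have e1 := intervalIntegral.integral_interval_sub_left
    (h.intervalIntegrable_mass le_rfl ht) (h.intervalIntegrable_mass le_rfl hs.1.1)
  have e2 := intervalIntegral.integral_interval_sub_left (hwI 0 t) (hwI 0 s)
  have e3 : ∫ r in s..t, w r * lap (ν r) 0 ≤ (∫ r in s..t, w r) * lap (ν 0) y := by
    rw [← intervalIntegral.integral_mul_const]
    refine intervalIntegral.integral_mono_on_of_le_Ioo hst (h.intervalIntegrable_mass hs.1.1 hst)
      ((h.continuous_weight.mul continuous_const).intervalIntegrable _ _) fun r hr => ?_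
    exact mul_le_mul_of_nonneg_left (hafter r ⟨hr.1, hr.2.le⟩) (h.weight_pos r).le
  have hκs : κ s ≤ 0 := hs.2
  simp only [hκ] at hκs
  rw [← e1, ← e2, sub_mul] at e3
  linarith

/-- A solution at a given time depends only on its initial value and on the total weight. -/
theorem eq_of_weight_eq (h : WeightedSolution w ν) {w' : ℝ → ℝ} {ν' : ℝ → Measure MassSpace}
    (h' : WeightedSolution w' ν') (h0 : ν 0 = ν' 0) {t : ℝ} (ht : 0 ≤ t)
    (hW : ∫ r in (0 : ℝ)..t, w r = ∫ r in (0 : ℝ)..t, w' r) : ν t = ν' t := by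
  have a1 := h.lap_gel_point ht
  have a2 := h'.lap_gel_point ht
  have b1 := h.weight_mul_mass_le ht
  have b2 := h'.weight_mul_mass_le ht
  -- Each gel point is a competitor in the minimum for the other solution, which gives equality of
  -- the two mass integrals.
  have c1 := h.mass_integral_le ht (sub_nonneg.2 b2)
  have c2 := h'.mass_integral_le ht (sub_nonneg.2 b1)
  rw [h0] at c1
  rw [← h0] at c2
  have hWn := h.weight_integral_nonneg ht
  have hch := fun x (hx : 0 ≤ x) => h.characteristic ht hx
  have hch' := fun x (hx : 0 ≤ x) => h'.characteristic ht hx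
  rw [← hW] at a2 b2 c1 c2 hch'
  rw [a2] at c1
  rw [a1] at c2
  have hA : ∫ r in (0 : ℝ)..t, w r * lap (ν r) 0 = ∫ r in (0 : ℝ)..t, w' r * lap (ν' r) 0 := by
    linarith
  rw [← h0, ← hA] at hch'
  rw [← h0, ← hA] at a2
  rw [← hA] at b2
  set A := ∫ r in (0 : ℝ)..t, w r * lap (ν r) 0
  set W := ∫ r in (0 : ℝ)..t, w r
  have hconv : ConvexOn ℝ (Ici 0) fun y => y + W * lap (ν 0) y :=
    (convexOn_id (convex_Ici 0)).add (h.hasMass_zero.convexOn_lap.smul hWn)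
  -- A convex function that has risen above its value at l keeps increasing strictly, so to the
  -- right of l the equation y + W g_0(y) = x + A has at most one solution when x > 0.
  have huniq : ∀ l y y', 0 ≤ l → l < y → y < y' → l + W * lap (ν 0) l < y + W * lap (ν 0) y →
      y + W * lap (ν 0) y < y' + W * lap (ν 0) y' := by
    intro l y y' hl hly hyy hlt
    refine hconv.lt_right_of_left_lt (mem_Ici.2 hl)
      (mem_Ici.2 (hl.trans (hly.trans hyy).le)) ?_ hlt
    rw [openSegment_eq_Ioo (hly.trans hyy)]
    exact ⟨hly, hyy⟩
  refine eq_of_lap_eq (h.hasMass ht) (h'.hasMass ht) fun x hx => ?_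
  have g1 := hch x hx.le
  have g2 := hch' x hx.le
  have k1 := mul_le_mul_of_nonneg_left ((h.hasMass ht).lap_anti le_rfl hx.le) hWn
  have k2 := mul_le_mul_of_nonneg_left ((h'.hasMass ht).lap_anti le_rfl hx.le) hWn
  rcases lt_trichotomy (x + A - W * lap (ν t) x) (x + A - W * lap (ν' t) x) with hlt | heq | hgt
  · have := huniq (A - W * lap (ν t) 0) _ _ (sub_nonneg.2 b1) (by linarith) hlt
      (by rw [a1, g1]; linarith)
    rw [g1, g2] at this
    linarith
  · rw [← g1, ← g2, heq]
  · have := huniq (A - W * lap (ν' t) 0) _ _ (sub_nonneg.2 b2) (by linarith) hgt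
      (by rw [a2, g2]; linarith)
    rw [g1, g2] at this
    linarith

end WeightedSolution

/-! ### Minimizers of `y ↦ y + τ ⟨μ, m e^{-ym}⟩` -/

namespace HasMass

variable {μ : Measure MassSpace}

/-- Minimality bounds the integrated difference quotients of m e^{-xm} to the right of l by 1/τ, and
Fatou passes to the limit. This covers l = 0, where finiteness of the second moment is part of the
conclusion. -/
theorem lapTwo_le_of_isMin (hμ : HasMass μ) {τ l : ℝ} (hτ : 0 < τ) (hl : 0 ≤ l)
    (hmin : ∀ y, 0 ≤ y → l + τ * lap μ l ≤ y + τ * lap μ y) :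
    Integrable (fun m : MassSpace => (m : ℝ) ^ 2 * Real.exp (-(l * m))) μ ∧
      τ * lapTwo μ l ≤ 1 := by
  let ε : ℕ → ℝ := fun n => 1 / ((n : ℝ) + 1)
  have hε : ∀ n, 0 < ε n := fun n => by positivity
  let F : ℕ → MassSpace → ℝ := fun n m =>
    (ε n)⁻¹ * ((m : ℝ) * Real.exp (-(l * m)) - (m : ℝ) * Real.exp (-((l + ε n) * m)))
  have hFint : ∀ n, Integrable (F n) μ := fun n =>
    ((hμ.integrable_lap hl).sub (hμ.integrable_lap (add_nonneg hl (hε n).le))).const_mul _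
  have hF0 : ∀ n m, 0 ≤ F n m := fun n m => by
    have h1 := m.2
    have h2 := hε n
    refine mul_nonneg (by positivity) (sub_nonneg.2 (mul_le_mul_of_nonneg_left
      (Real.exp_le_exp.2 ?_) h1.le))
    nlinarith
  have hFle : ∀ n, ∫⁻ m, ENNReal.ofReal (F n m) ∂μ ≤ ENNReal.ofReal (1 / τ) := fun n => by
    rw [← ofReal_integral_eq_lintegral_ofReal (hFint n) (ae_of_all _ (hF0 n))]
    refine ENNReal.ofReal_le_ofReal ?_
    have h2 := hε n
    have h3 := hmin (l + ε n) (add_nonneg hl h2.le)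
    simp only [F]
    rw [integral_const_mul, integral_sub (hμ.integrable_lap hl)
      (hμ.integrable_lap (add_nonneg hl h2.le)), inv_mul_le_iff₀ h2, mul_one_div, le_div_iff₀ hτ]
    simp only [lap] at h3
    linarith
  have hlim : ∀ m : MassSpace, Tendsto (fun n => F n m) atTop
      (𝓝 ((m : ℝ) ^ 2 * Real.exp (-(l * m)))) := fun m => by
    have hd : HasDerivAt (fun x : ℝ => (m : ℝ) * Real.exp (-(x * m)))
        (-((m : ℝ) ^ 2 * Real.exp (-(l * m)))) l := by
      have h := (((hasDerivAt_id l).mul_const (m : ℝ)).neg.exp).const_mul (m : ℝ)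
      convert! h using 1
      simp; ring
    have hε0 : Tendsto ε atTop (𝓝[≠] 0) :=
      tendsto_nhdsWithin_iff.2 ⟨tendsto_one_div_add_atTop_nhds_zero_nat,
        Eventually.of_forall fun n => (hε n).ne'⟩
    have h := (hd.tendsto_slope_zero.comp hε0).neg
    rw [neg_neg] at h
    refine h.congr fun n => ?_
    simp only [F, Function.comp, smul_eq_mul]
    ring
  have hle : ∫⁻ m : MassSpace, ENNReal.ofReal ((m : ℝ) ^ 2 * Real.exp (-(l * m))) ∂μ ≤
      ENNReal.ofReal (1 / τ) := by
    calc _ = ∫⁻ m, liminf (fun n => ENNReal.ofReal (F n m)) atTop ∂μ :=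
          lintegral_congr fun m =>
            (((ENNReal.continuous_ofReal.tendsto _).comp (hlim m)).liminf_eq).symm
      _ ≤ liminf (fun n => ∫⁻ m, ENNReal.ofReal (F n m) ∂μ) atTop :=
          lintegral_liminf_le fun n => by fun_prop
      _ ≤ liminf (fun _ : ℕ => ENNReal.ofReal (1 / τ)) atTop :=
          liminf_le_liminf (Eventually.of_forall hFle)
      _ = _ := liminf_const _
  have hnn : ∀ m : MassSpace, 0 ≤ (m : ℝ) ^ 2 * Real.exp (-(l * m)) := fun m => by positivity
  have hint : Integrable (fun m : MassSpace => (m : ℝ) ^ 2 * Real.exp (-(l * m))) μ := by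
    refine ⟨by fun_prop, ?_⟩
    rw [hasFiniteIntegral_iff_ofReal (ae_of_all _ hnn)]
    exact hle.trans_lt ENNReal.ofReal_lt_top
  refine ⟨hint, ?_⟩
  rw [← ofReal_integral_eq_lintegral_ofReal hint (ae_of_all _ hnn),
    ENNReal.ofReal_le_ofReal_iff (by positivity)] at hle
  rwa [le_div_iff₀ hτ, mul_comm] at hle

theorem lapTwo_eq_of_isMin (hμ : HasMass μ) {τ l : ℝ} (hl : 0 < l)
    (hmin : ∀ y, 0 ≤ y → l + τ * lap μ l ≤ y + τ * lap μ y) : τ * lapTwo μ l = 1 := by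
  have hloc : IsLocalMin (fun y => y + τ * lap μ y) l := by
    filter_upwards [lt_mem_nhds hl] with y hy using hmin y hy.le
  have h := hloc.hasDerivAt_eq_zero ((hasDerivAt_id l).add ((hμ.hasDerivAt_lap hl).const_mul τ))
  linarith

/-- The transform `lap` is logarithmically convex. -/
theorem lap_mul_lapTwo_le (hμ : HasMass μ) (h0 : μ ≠ 0) {a b : ℝ} (ha : 0 ≤ a) (hab : a < b)
    (hint : Integrable (fun m : MassSpace => (m : ℝ) ^ 2 * Real.exp (-(a * m))) μ) :
    lap μ a * lapTwo μ b ≤ lap μ b * lapTwo μ a := by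
  have hb : 0 < b := ha.trans_lt hab
  have hgb := hμ.lap_pos h0 hb.le
  -- The mean of m under the weight m e^{-bm}; this choice kills the left side of the Chebyshev-type
  -- inequality `hkey`.
  set c := lapTwo μ b / lap μ b with hc
  have hcb : lapTwo μ b = c * lap μ b := by rw [hc]; field_simp
  have hintb := hμ.integrable_lapTwo hb
  have hsub : ∀ z, 0 ≤ z → Integrable (fun m : MassSpace => (m : ℝ) ^ 2 * Real.exp (-(z * m))) μ →
      Integrable (fun m : MassSpace => (m : ℝ) ^ 2 * Real.exp (-(z * m)) -
        c * ((m : ℝ) * Real.exp (-(z * m)))) μ ∧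
      ∫ m : MassSpace, ((m : ℝ) ^ 2 * Real.exp (-(z * m)) -
        c * ((m : ℝ) * Real.exp (-(z * m)))) ∂μ = lapTwo μ z - c * lap μ z := by
    intro z hz hi
    have hi' := (hμ.integrable_lap hz).const_mul c
    refine ⟨hi.sub hi', ?_⟩
    rw [integral_sub hi hi', integral_const_mul, lapTwo, lap]
  obtain ⟨ia, ea⟩ := hsub a ha hint
  obtain ⟨ib, eb⟩ := hsub b hb.le hintb
  have hkey : Real.exp ((b - a) * c) * (lapTwo μ b - c * lap μ b) ≤ lapTwo μ a - c * lap μ a := by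
    rw [← ea, ← eb, ← integral_const_mul]
    refine integral_mono (ib.const_mul _) ia fun m => ?_
    have hm := m.2
    have hexp : Real.exp (-(a * m)) = Real.exp (-(b * m)) * Real.exp ((b - a) * m) := by
      rw [← Real.exp_add]; ring_nf
    have hcheb : 0 ≤ ((m : ℝ) - c) * (Real.exp ((b - a) * m) - Real.exp ((b - a) * c)) := by
      have hba := sub_pos.2 hab
      rcases le_total c m with hcm | hcm
      · exact mul_nonneg (sub_nonneg.2 hcm) (sub_nonneg.2 (Real.exp_le_exp.2 (by gcongr)))
      · exact mul_nonneg_of_nonpos_of_nonpos (sub_nonpos.2 hcm)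
          (sub_nonpos.2 (Real.exp_le_exp.2 (by gcongr)))
    have hw : 0 ≤ (m : ℝ) * Real.exp (-(b * m)) := by positivity
    have := mul_nonneg hw hcheb
    simp only
    rw [hexp]
    linarith
  rw [hcb, sub_self, mul_zero] at hkey
  rw [hcb]
  nlinarith

/-- When l₁ < l₂, the point l₂ is interior, so τ₂ `lapTwo` = 1 there while τ₁ `lapTwo` ≤ 1 at l₁;
log-convexity turns this into the claim. -/
theorem mul_lap_le_of_isMin (hμ : HasMass μ) (h0 : μ ≠ 0) {τ₁ τ₂ l₁ l₂ : ℝ} (hτ₁ : 0 < τ₁)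
    (hτ : τ₁ ≤ τ₂) (hl₁ : 0 ≤ l₁) (hl₂ : 0 ≤ l₂)
    (hmin₁ : ∀ y, 0 ≤ y → l₁ + τ₁ * lap μ l₁ ≤ y + τ₁ * lap μ y)
    (hmin₂ : ∀ y, 0 ≤ y → l₂ + τ₂ * lap μ l₂ ≤ y + τ₂ * lap μ y) :
    τ₁ * lap μ l₁ ≤ τ₂ * lap μ l₂ := by
  have hτ₂ := hτ₁.trans_le hτ
  rcases le_or_gt l₂ l₁ with hle | hlt
  · exact mul_le_mul hτ (hμ.lap_anti hl₂ hle) (lap_nonneg _ _) hτ₂.le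
  · obtain ⟨hint, h1⟩ := hμ.lapTwo_le_of_isMin hτ₁ hl₁ hmin₁
    have h2 := hμ.lapTwo_eq_of_isMin (hl₁.trans_lt hlt) hmin₂
    have h3 := hμ.lap_mul_lapTwo_le h0 hl₁ hlt hint
    calc τ₁ * lap μ l₁ = τ₁ * τ₂ * (lap μ l₁ * lapTwo μ l₂) := by
          linear_combination (-(τ₁ * lap μ l₁)) * h2
      _ ≤ τ₁ * τ₂ * (lap μ l₂ * lapTwo μ l₁) := by gcongr
      _ = (τ₂ * lap μ l₂) * (τ₁ * lapTwo μ l₁) := by ring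
      _ ≤ τ₂ * lap μ l₂ :=
        mul_le_of_le_one_right (mul_nonneg hτ₂.le (lap_nonneg _ _)) h1

/-- Up to the gelation time the minimizer is `0`. -/
theorem mul_lap_zero_le (hμ : HasMass μ) {τ y : ℝ} (hτ : 0 ≤ τ) (hy : 0 ≤ y)
    (h : ENNReal.ofReal τ ≤ gelationTime μ) : τ * lap μ 0 ≤ y + τ * lap μ y := by
  rcases hτ.eq_or_lt with rfl | hτ
  · simpa using hy
  have hsm : secondMoment μ ≤ ENNReal.ofReal (1 / τ) := by
    rw [one_div, ENNReal.ofReal_inv_of_pos hτ]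
    exact ENNReal.le_inv_iff_le_inv.1 h
  have hint : Integrable (fun m : MassSpace => (m : ℝ) ^ 2) μ := by
    refine ⟨by fun_prop, ?_⟩
    rw [hasFiniteIntegral_iff_ofReal (ae_of_all _ fun m => by positivity)]
    exact hsm.trans_lt ENNReal.ofReal_lt_top
  rw [secondMoment, ← ofReal_integral_eq_lintegral_ofReal hint
    (ae_of_all _ fun m => by positivity), ENNReal.ofReal_le_ofReal_iff (by positivity),
    le_div_iff₀ hτ] at hsm
  have hle : lap μ 0 - lap μ y ≤ y * ∫ m : MassSpace, (m : ℝ) ^ 2 ∂μ := by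
    rw [lap_zero, lap, ← integral_sub hμ (hμ.integrable_lap hy), ← integral_const_mul]
    refine integral_mono (hμ.sub (hμ.integrable_lap hy)) (hint.const_mul _) fun m => ?_
    have := mul_le_mul_of_nonneg_left (one_sub_exp_le y m) m.2.le
    simp only
    linarith
  nlinarith [mul_le_mul_of_nonneg_left hle hτ.le, mul_le_mul_of_nonneg_left hsm hy]

/-- If `0` is a minimizer, then gelation has not happened. -/
theorem le_gelationTime_of_isMin (hμ : HasMass μ) {τ : ℝ} (hτ : 0 < τ)
    (hmin : ∀ y, 0 ≤ y → τ * lap μ 0 ≤ y + τ * lap μ y) :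
    ENNReal.ofReal τ ≤ gelationTime μ := by
  obtain ⟨hint, h1⟩ := hμ.lapTwo_le_of_isMin hτ le_rfl (by simpa using hmin)
  rw [gelationTime, ENNReal.le_inv_iff_le_inv, ← ENNReal.ofReal_inv_of_pos hτ]
  have hsm : secondMoment μ = ENNReal.ofReal (lapTwo μ 0) := by
    rw [lapTwo, ofReal_integral_eq_lintegral_ofReal hint (ae_of_all _ fun m => by positivity)]
    simp [secondMoment]
  rw [hsm]
  refine ENNReal.ofReal_le_ofReal ?_
  rw [← one_div, le_div_iff₀ hτ, mul_comm]
  exact h1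

end HasMass

/-! ### From Flory's equation to a weighted equation -/

/-- The function f is bounded on the interval, and the exponential is Lipschitz on a half-line
bounded above. -/
theorem _root_.AbsolutelyContinuousOnInterval.exp {f : ℝ → ℝ} {a b : ℝ}
    (hf : AbsolutelyContinuousOnInterval f a b) :
    AbsolutelyContinuousOnInterval (fun x => Real.exp (f x)) a b := by
  obtain ⟨C, hC⟩ := hf.exists_bound
  have hlip : ∀ x ∈ uIcc a b, ∀ y ∈ uIcc a b,
      dist (Real.exp (f x)) (Real.exp (f y)) ≤ Real.exp C * dist (f x) (f y) := by
    intro x hx y hy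
    have hle : ∀ z ∈ uIcc a b, f z ∈ Iic C := fun z hz => (le_abs_self _).trans (hC z hz)
    have := (convex_Iic C).norm_image_sub_le_of_norm_hasDerivWithin_le
      (f := Real.exp) (f' := Real.exp) (C := Real.exp C)
      (fun z _ => (Real.hasDerivAt_exp z).hasDerivWithinAt)
      (fun z hz => by
        rw [Real.norm_of_nonneg (Real.exp_pos z).le]
        exact Real.exp_le_exp.2 hz) (hle y hy) (hle x hx)
    rwa [← dist_eq_norm, ← dist_eq_norm] at this
  rw [absolutelyContinuousOnInterval_iff] at hf ⊢
  intro ε hε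
  obtain ⟨δ, hδ, h⟩ := hf (ε / Real.exp C) (by positivity)
  refine ⟨δ, hδ, fun E hE hsum => ?_⟩
  refine lt_of_le_of_lt (Finset.sum_le_sum fun i hi =>
    hlip _ (hE.1 i hi).1 _ (hE.1 i hi).2) ?_
  rw [← Finset.mul_sum, mul_comm, ← lt_div_iff₀ (Real.exp_pos C)]
  exact h E hE hsum

/-- The integrating factor for a linear integral equation with integrable coefficients. -/
theorem exp_mul_eq_of_integral_equation {k b u : ℝ → ℝ} {T : ℝ} (hT : 0 ≤ T)
    (hk : IntervalIntegrable k volume 0 T) (hb : IntervalIntegrable b volume 0 T)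
    (hu : ∀ t ∈ Icc 0 T, u t = u 0 + ∫ s in (0 : ℝ)..t, (b s - u s * k s))
    (huk : IntervalIntegrable (fun s => u s * k s) volume 0 T) :
    Real.exp (∫ s in (0 : ℝ)..T, k s) * u T =
      u 0 + ∫ s in (0 : ℝ)..T, Real.exp (∫ r in (0 : ℝ)..s, k r) * b s := by
  have h0 : (0 : ℝ) ∈ uIcc 0 T := left_mem_uIcc
  have hT' : T ∈ uIcc 0 T := right_mem_uIcc
  have hKac := hk.absolutelyContinuousOnInterval_intervalIntegral h0
  have hEac := hKac.exp
  have hbu := hb.sub huk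
  have hUac : AbsolutelyContinuousOnInterval
      (fun t => u 0 + ∫ s in (0 : ℝ)..t, (b s - u s * k s)) 0 T :=
    ((contDiffOn_const (c := u 0)).absolutelyContinuousOnInterval).add
      (hbu.absolutelyContinuousOnInterval_intervalIntegral h0)
  have hEb : IntervalIntegrable (fun s => Real.exp (∫ r in (0 : ℝ)..s, k r) * b s) volume 0 T :=
    hb.continuousOn_mul hEac.continuousOn
  have hac := (hEac.mul hUac).sub (hEb.absolutelyContinuousOnInterval_intervalIntegral h0)
  -- The coefficients are merely integrable, so the product rule holds only almost everywhere;
  -- absolute continuity makes that enough.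
  obtain ⟨C, hC⟩ := hac.const_of_ae_hasDerivAt_zero (by
    filter_upwards [hk.ae_hasDerivAt_integral, hbu.ae_hasDerivAt_integral,
      hEb.ae_hasDerivAt_integral] with t d1 d2 d3 ht
    have hd := (((d1 ht 0 h0).exp).mul ((d2 ht 0 h0).const_add (u 0))).sub (d3 ht 0 h0)
    convert! hd using 1
    rw [uIcc_of_le hT] at ht
    rw [← hu t ht]
    ring)
  have e1 := hC 0 h0
  have e2 := hC T hT'
  simp only [Pi.sub_apply, Pi.mul_apply, intervalIntegral.integral_same, Real.exp_zero, one_mul,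
    add_zero, sub_zero] at e1 e2
  rw [← hu T ⟨hT, le_rfl⟩] at e2
  linarith

theorem lap_smul (c : NNReal) (μ : Measure MassSpace) (x : ℝ) :
    lap (c • μ) x = c * lap μ x := by
  rw [lap, integral_smul_nnreal_measure, lap, NNReal.smul_def, smul_eq_mul]

theorem firstMoment_smul (c : NNReal) (μ : Measure MassSpace) :
    firstMoment (c • μ) = c * firstMoment μ := by
  rw [firstMoment, lintegral_smul_measure, firstMoment, ENNReal.smul_def, smul_eq_mul]

theorem coagTerm_smul (c : NNReal) (μ : Measure MassSpace) [IsLocallyFiniteMeasure μ]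
    (φ : MassSpace → ℝ) : coagTerm (c • μ) φ = (c : ℝ) ^ 2 * coagTerm μ φ := by
  rw [coagTerm, Measure.prod_smul_left, Measure.prod_smul_right, integral_smul_nnreal_measure,
    integral_smul_nnreal_measure, coagTerm, NNReal.smul_def, NNReal.smul_def, smul_eq_mul,
    smul_eq_mul]
  ring

/-- The gel mass `⟨μ₀ - μ_s, m⟩`, extended by `0` to nonpositive times. -/
noncomputable def gelMass (μ : ℝ → Measure MassSpace) : ℝ → ℝ :=
  indicator (Ioi 0) fun s => lap (μ 0) 0 - lap (μ s) 0

/-- The time integral of the gel mass. -/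
noncomputable def gelIntegral (μ : ℝ → Measure MassSpace) (t : ℝ) : ℝ :=
  ∫ s in (0 : ℝ)..t, gelMass μ s

/-- The solution of Flory's equation multiplied by the integrating factor of the gel term. -/
noncomputable def ungel (μ : ℝ → Measure MassSpace) (t : ℝ) : Measure MassSpace :=
  (Real.exp (gelIntegral μ t)).toNNReal • μ t

namespace SolvesFlory

variable {μ : ℝ → Measure MassSpace}

theorem aemeasurable_firstMoment (h : SolvesFlory μ) {t : ℝ} (ht : 0 < t) :
    AEMeasurable (fun s => firstMoment (μ s)) (volume.restrict (Ioc 0 t)) := by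
  refine Coagulation.aemeasurable_firstMoment h.radon fun φ hφ hc => ?_
  obtain ⟨h1, h2, -⟩ := h.equation φ hφ hc t ht
  have hcont : ContinuousOn (fun s => ∫ m, φ m ∂(μ 0) +
      1 / 2 * (∫ r in (0 : ℝ)..s, coagTerm (μ r) φ)
        - ∫ r in (0 : ℝ)..s, gelTerm (μ 0) (μ r) φ) (Icc 0 t) := by
    have c1 := intervalIntegral.continuousOn_primitive_interval' h1 left_mem_uIcc
    have c2 := intervalIntegral.continuousOn_primitive_interval' h2 left_mem_uIcc
    rw [uIcc_of_le ht.le] at c1 c2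
    fun_prop
  refine ((hcont.mono Ioc_subset_Icc_self).aemeasurable measurableSet_Ioc).congr ?_
  filter_upwards [ae_restrict_mem measurableSet_Ioc] with s hs
  exact (h.equation φ hφ hc s hs.1).2.2.symm

theorem integrableOn_mass (h : SolvesFlory μ) {t : ℝ} (ht : 0 < t) :
    IntegrableOn (fun s => lap (μ s) 0) (Ioc 0 t) := by
  have hM := h.aemeasurable_firstMoment ht
  have hsq := integrableOn_sq_lap_zero hM (h.sq_integrable t ht)
  have hone : IntegrableOn (fun _ : ℝ => (1 : ℝ)) (Ioc 0 t) := by simp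
  refine Integrable.mono' (hsq.add hone) ?_ (ae_of_all _ fun s => ?_)
  · simp_rw [← toReal_firstMoment]
    exact hM.ennreal_toReal.aestronglyMeasurable
  · have := lap_nonneg (μ s) 0
    rw [Real.norm_of_nonneg this]
    simp only [Pi.add_apply]
    nlinarith [sq_nonneg (lap (μ s) 0 - 1)]

theorem intervalIntegrable_gelMass (h : SolvesFlory μ) (a b : ℝ) :
    IntervalIntegrable (gelMass μ) volume a b := by
  have key : ∀ a b, IntegrableOn (gelMass μ) (Ioc a b) := by
    intro a b
    rw [gelMass, integrableOn_indicator_iff measurableSet_Ioi]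
    have hone : IntegrableOn (fun _ : ℝ => lap (μ 0) 0) (Ioc 0 (max b 1)) := by simp
    refine (hone.sub (h.integrableOn_mass (t := max b 1) (by positivity))).mono_set ?_
    exact fun s hs => ⟨hs.1, hs.2.2.trans (le_max_left _ _)⟩
  exact ⟨key a b, key b a⟩

theorem continuous_gelIntegral (h : SolvesFlory μ) : Continuous (gelIntegral μ) :=
  intervalIntegral.continuous_primitive h.intervalIntegrable_gelMass 0

theorem gelIntegral_zero (μ : ℝ → Measure MassSpace) : gelIntegral μ 0 = 0 := by
  simp [gelIntegral]

theorem ungel_zero (μ : ℝ → Measure MassSpace) : ungel μ 0 = μ 0 := by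
  simp [ungel, gelIntegral_zero]

theorem coe_toNNReal_exp (x : ℝ) : ((Real.exp x).toNNReal : ℝ) = Real.exp x :=
  Real.coe_toNNReal _ (Real.exp_pos x).le

theorem lap_ungel (μ : ℝ → Measure MassSpace) (t x : ℝ) :
    lap (ungel μ t) x = Real.exp (gelIntegral μ t) * lap (μ t) x := by
  rw [ungel, lap_smul, coe_toNNReal_exp]

/-- The factor e^{K} absorbs the linear gel term. The coagulation term is quadratic, so e^{K} times
it equals e^{-K} times the term of the rescaled measure. -/
theorem weightedSolution (h : SolvesFlory μ) (hmass : firstMoment (μ 0) < ∞) :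
    WeightedSolution (fun t => Real.exp (-gelIntegral μ t)) (ungel μ) where
  continuous_weight := Real.continuous_exp.comp h.continuous_gelIntegral.neg
  weight_pos t := Real.exp_pos _
  radon t ht := by
    have := h.radon t ht
    unfold ungel
    infer_instance
  hasMass_zero := by rw [ungel_zero]; exact hasMass_iff.2 hmass
  sq_integrable t ht := by
    obtain ⟨B, hB⟩ := isCompact_Icc.exists_bound_of_continuousOn
      ((Real.continuous_exp.comp h.continuous_gelIntegral).continuousOn (s := Icc 0 t))
    have hle : ∫⁻ s in Ioc 0 t, firstMoment (ungel μ s) ^ 2 ≤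
        ∫⁻ s in Ioc 0 t, ENNReal.ofReal B ^ 2 * firstMoment (μ s) ^ 2 := by
      refine setLIntegral_mono_ae' measurableSet_Ioc (ae_of_all _ fun s hs => ?_)
      rw [ungel, firstMoment_smul, mul_pow]
      gcongr
      exact ENNReal.ofReal_le_ofReal
        ((le_abs_self _).trans (hB s ⟨hs.1.le, hs.2⟩))
    refine hle.trans_lt ?_
    rw [lintegral_const_mul' _ _ (by finiteness)]
    exact ENNReal.mul_lt_top (by finiteness) (h.sq_integrable t ht)
  equation φ hφ hc t ht := by
    obtain ⟨h1, h2, h3⟩ := h.equation φ hφ hc t ht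
    have hcoag : EqOn (fun s => Real.exp (gelIntegral μ s) * coagTerm (μ s) φ)
        (fun s => Real.exp (-gelIntegral μ s) * coagTerm (ungel μ s) φ) (uIcc 0 t) := by
      intro s hs
      rw [uIcc_of_le ht.le] at hs
      have := h.radon s hs.1
      simp only
      rw [ungel, coagTerm_smul, coe_toNNReal_exp, Real.exp_neg]
      field_simp
    have hEc : IntervalIntegrable (fun s => Real.exp (gelIntegral μ s) * coagTerm (μ s) φ)
        volume 0 t :=
      h1.continuousOn_mul (Real.continuous_exp.comp h.continuous_gelIntegral).continuousOn
    have hgel : ∀ r, 0 ≤ r → EqOn (fun s => gelTerm (μ 0) (μ s) φ)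
        (fun s => (∫ m, φ m ∂(μ s)) * gelMass μ s) (uIoc 0 r) := by
      intro r hr s hs
      rw [uIoc_of_le hr] at hs
      simp only [gelTerm, toReal_firstMoment, gelMass]
      rw [indicator_of_mem (mem_Ioi.2 hs.1)]
    have hint : ∀ r, 0 ≤ r → ∫ s in (0 : ℝ)..r, gelTerm (μ 0) (μ s) φ =
        ∫ s in (0 : ℝ)..r, (∫ m, φ m ∂(μ s)) * gelMass μ s := fun r hr =>
      intervalIntegral.integral_congr_ae (ae_of_all _ fun s hs => hgel r hr hs)
    refine ⟨hEc.congr (hcoag.mono uIoc_subset_uIcc), ?_⟩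
    have huk : IntervalIntegrable (fun s => (∫ m, φ m ∂(μ s)) * gelMass μ s) volume 0 t :=
      h2.congr (hgel t ht.le)
    have hkey := exp_mul_eq_of_integral_equation (T := t) (k := gelMass μ)
      (b := fun s => 1 / 2 * coagTerm (μ s) φ) (u := fun s => ∫ m, φ m ∂(μ s)) ht.le
      (h.intervalIntegrable_gelMass 0 t) (h1.const_mul _) (fun s hs => ?_) huk
    · rw [← intervalIntegral.integral_congr hcoag, ← intervalIntegral.integral_const_mul,
        ungel_zero, ungel, integral_smul_nnreal_measure, NNReal.smul_def, coe_toNNReal_exp,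
        smul_eq_mul]
      refine hkey.trans ?_
      congr 1
      refine intervalIntegral.integral_congr fun s _ => ?_
      simp only [gelIntegral]
      ring
    · rcases hs.1.eq_or_lt with rfl | hs0
      · simp
      have hsub : uIcc 0 s ⊆ uIcc 0 t := by
        rw [uIcc_of_le hs.1, uIcc_of_le ht.le]
        exact Icc_subset_Icc_right hs.2
      rw [intervalIntegral.integral_sub ((h1.mono_set hsub).const_mul _) (huk.mono_set hsub),
        intervalIntegral.integral_const_mul, ← hint s hs.1]
      exact (h.equation φ hφ hc s hs0).2.2.trans (add_sub_assoc _ _ _)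

end SolvesFlory

theorem SolvesSmoluchowski.weightedSolution {μ : ℝ → Measure MassSpace}
    (h : SolvesSmoluchowski μ) (hmass : firstMoment (μ 0) < ∞) :
    WeightedSolution (fun _ => 1) μ where
  continuous_weight := continuous_const
  weight_pos _ := one_pos
  radon := h.radon
  hasMass_zero := hasMass_iff.2 hmass
  sq_integrable := h.sq_integrable
  equation := by simpa only [one_mul] using h.equation

/-! ### Comparison of the two equations -/

theorem hasDerivAt_exp_sub_exp {D : ℝ → ℝ} (hD : Continuous D) (c t : ℝ) :
    HasDerivAt (fun t => Real.exp (-(c * ∫ s in (0 : ℝ)..t, D s)) - Real.exp (-(c * t)))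
      (c * (Real.exp (-(c * t)) - D t * Real.exp (-(c * ∫ s in (0 : ℝ)..t, D s)))) t := by
  have h1 := (((hD.integral_hasStrictDerivAt 0 t).hasDerivAt.const_mul c).neg).exp
  have h2 := (((hasDerivAt_id t).const_mul c).neg).exp
  convert! h1.sub h2 using 1
  simp only [id, Pi.neg_apply]
  ring

/-- The hypothesis says that e^{-c∫D} - e^{-cs} is nondecreasing in s, and it vanishes at 0. The
case c = 0 is separate because c is cancelled at the end. -/
theorem integral_le_of_le_exp {D : ℝ → ℝ} (hD : Continuous D) {c t : ℝ} (hc : 0 ≤ c) (ht : 0 ≤ t)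
    (h : ∀ s ∈ Icc 0 t, D s ≤ Real.exp (c * (∫ r in (0 : ℝ)..s, D r) - c * s)) :
    ∫ s in (0 : ℝ)..t, D s ≤ t := by
  rcases hc.eq_or_lt with rfl | hc
  · have := intervalIntegral.integral_mono_on (μ := volume) ht (hD.intervalIntegrable 0 t)
      intervalIntegrable_const (g := fun _ => (1 : ℝ))
      fun s hs => by simpa using h s hs
    simpa using this
  have hder := fun s => hasDerivAt_exp_sub_exp hD c s
  have hmono := monotoneOn_of_deriv_nonneg (convex_Icc 0 t)
    (fun s _ => (hder s).continuousAt.continuousWithinAt)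
    (fun s _ => (hder s).differentiableAt.differentiableWithinAt) (fun s hs => by
      rw [interior_Icc] at hs
      rw [(hder s).deriv]
      refine mul_nonneg hc.le (sub_nonneg.2 ?_)
      refine (mul_le_mul_of_nonneg_right (h s (Ioo_subset_Icc_self hs))
        (Real.exp_pos _).le).trans_eq ?_
      rw [← Real.exp_add]
      ring_nf)
  have := hmono (left_mem_Icc.2 ht) (right_mem_Icc.2 ht) ht
  simp only [intervalIntegral.integral_same, mul_zero, sub_self] at this
  have h2 := Real.exp_le_exp.1 (sub_nonneg.1 this)
  nlinarith

theorem le_integral_of_exp_le {D : ℝ → ℝ} (hD : Continuous D) {c t : ℝ} (hc : 0 ≤ c) (ht : 0 ≤ t)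
    (h : ∀ s ∈ Icc 0 t, Real.exp (c * (∫ r in (0 : ℝ)..s, D r) - c * s) ≤ D s) :
    t ≤ ∫ s in (0 : ℝ)..t, D s := by
  rcases hc.eq_or_lt with rfl | hc
  · have := intervalIntegral.integral_mono_on (μ := volume) ht
      intervalIntegrable_const (hD.intervalIntegrable 0 t) (f := fun _ => (1 : ℝ))
      fun s hs => by simpa using h s hs
    simpa using this
  have hder := fun s => hasDerivAt_exp_sub_exp hD c s
  have hanti := antitoneOn_of_deriv_nonpos (convex_Icc 0 t)
    (fun s _ => (hder s).continuousAt.continuousWithinAt)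
    (fun s _ => (hder s).differentiableAt.differentiableWithinAt) (fun s hs => by
      rw [interior_Icc] at hs
      rw [(hder s).deriv]
      refine mul_nonpos_of_nonneg_of_nonpos hc.le (sub_nonpos.2 ?_)
      refine Eq.trans_le ?_ (mul_le_mul_of_nonneg_right (h s (Ioo_subset_Icc_self hs))
        (Real.exp_pos _).le)
      rw [← Real.exp_add]
      ring_nf)
  have := hanti (left_mem_Icc.2 ht) (right_mem_Icc.2 ht) ht
  simp only [intervalIntegral.integral_same, mul_zero, sub_self] at this
  have h2 := Real.exp_le_exp.1 (sub_nonpos.1 this)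
  nlinarith

namespace WeightedSolution

variable {w : ℝ → ℝ} {ν : ℝ → Measure MassSpace}

/-- The current mass is the value of the initial transform at a minimizer. -/
theorem exists_isMin (h : WeightedSolution w ν) {t : ℝ} (ht : 0 ≤ t) :
    ∃ l, 0 ≤ l ∧ lap (ν 0) l = lap (ν t) 0 ∧
      ∀ y, 0 ≤ y → l + (∫ r in (0 : ℝ)..t, w r) * lap (ν 0) l ≤
        y + (∫ r in (0 : ℝ)..t, w r) * lap (ν 0) y := by
  refine ⟨_, sub_nonneg.2 (h.weight_mul_mass_le ht), h.lap_gel_point ht, fun y hy => ?_⟩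
  rw [h.lap_gel_point ht, sub_add_cancel]
  exact h.mass_integral_le ht hy

theorem mass_integral_le_mul (h : WeightedSolution w ν) {t : ℝ} (ht : 0 ≤ t) :
    ∫ r in (0 : ℝ)..t, w r * lap (ν r) 0 ≤ lap (ν 0) 0 * ∫ r in (0 : ℝ)..t, w r := by
  have := h.mass_integral_le ht le_rfl
  rwa [zero_add, mul_comm] at this

theorem mul_le_mass_integral (h : WeightedSolution w ν) {t : ℝ} (ht : 0 ≤ t)
    (hgel : ENNReal.ofReal (∫ r in (0 : ℝ)..t, w r) ≤ gelationTime (ν 0)) :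
    lap (ν 0) 0 * ∫ r in (0 : ℝ)..t, w r ≤ ∫ r in (0 : ℝ)..t, w r * lap (ν r) 0 := by
  have := h.hasMass_zero.mul_lap_zero_le (h.weight_integral_nonneg ht)
    (sub_nonneg.2 (h.weight_mul_mass_le ht)) hgel
  rwa [h.lap_gel_point ht, sub_add_cancel, mul_comm] at this

end WeightedSolution

/-! ### The gel integral before and after gelation -/

namespace SolvesFlory

variable {μ : ℝ → Measure MassSpace}

theorem gelIntegral_eq (h : SolvesFlory μ) {t : ℝ} (ht : 0 ≤ t) :
    gelIntegral μ t = lap (μ 0) 0 * t -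
      ∫ s in (0 : ℝ)..t, Real.exp (-gelIntegral μ s) * lap (ungel μ s) 0 := by
  rcases ht.eq_or_lt with rfl | ht
  · simp [gelIntegral]
  have h1 : ∀ s, Real.exp (-gelIntegral μ s) * lap (ungel μ s) 0 = lap (μ s) 0 := fun s => by
    rw [lap_ungel, ← mul_assoc, ← Real.exp_add, neg_add_cancel, Real.exp_zero, one_mul]
  have h2 : EqOn (gelMass μ) (fun s => lap (μ 0) 0 - lap (μ s) 0) (uIoc 0 t) := fun s hs => by
    rw [uIoc_of_le ht.le] at hs
    exact indicator_of_mem (mem_Ioi.2 hs.1) _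
  have h3 : IntervalIntegrable (fun s => lap (μ s) 0) volume 0 t :=
    (intervalIntegrable_iff_integrableOn_Ioc_of_le ht.le).2 (h.integrableOn_mass ht)
  simp_rw [h1]
  rw [gelIntegral, intervalIntegral.integral_congr_ae (ae_of_all _ fun s hs => h2 hs),
    intervalIntegral.integral_sub intervalIntegrable_const h3, intervalIntegral.integral_const]
  simp [mul_comm]

theorem continuous_exp_neg_gelIntegral (h : SolvesFlory μ) :
    Continuous fun s => Real.exp (-gelIntegral μ s) :=
  Real.continuous_exp.comp h.continuous_gelIntegral.neg

theorem neg_gelIntegral_le (h : SolvesFlory μ) (hmass : firstMoment (μ 0) < ∞)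
    {t : ℝ} (ht : 0 ≤ t) : -gelIntegral μ t ≤
    lap (μ 0) 0 * (∫ s in (0 : ℝ)..t, Real.exp (-gelIntegral μ s)) - lap (μ 0) 0 * t := by
  have := (h.weightedSolution hmass).mass_integral_le_mul ht
  rw [ungel_zero] at this
  rw [h.gelIntegral_eq ht]
  linarith

theorem weight_integral_le (h : SolvesFlory μ) (hmass : firstMoment (μ 0) < ∞)
    {t : ℝ} (ht : 0 ≤ t) :
    ∫ s in (0 : ℝ)..t, Real.exp (-gelIntegral μ s) ≤ t :=
  integral_le_of_le_exp h.continuous_exp_neg_gelIntegral (lap_nonneg (μ 0) 0) ht fun _ hs =>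
    Real.exp_le_exp.2 (h.neg_gelIntegral_le hmass hs.1)

theorem gelIntegral_nonneg (h : SolvesFlory μ) (hmass : firstMoment (μ 0) < ∞)
    {t : ℝ} (ht : 0 ≤ t) : 0 ≤ gelIntegral μ t := by
  have h1 := h.neg_gelIntegral_le hmass ht
  have h2 := mul_le_mul_of_nonneg_left (h.weight_integral_le hmass ht) (lap_nonneg (μ 0) 0)
  linarith

theorem gelIntegral_mono (h : SolvesFlory μ) (hmass : firstMoment (μ 0) < ∞)
    {s t : ℝ} (hs : 0 ≤ s) (hst : s ≤ t) :
    gelIntegral μ s ≤ gelIntegral μ t := by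
  have hw := h.weightedSolution hmass
  have ht := hs.trans hst
  have hsub := intervalIntegral.integral_interval_sub_left (hw.intervalIntegrable_mass le_rfl ht)
    (hw.intervalIntegrable_mass le_rfl hs)
  have hle : ∫ r in s..t, Real.exp (-gelIntegral μ r) * lap (ungel μ r) 0 ≤
      ∫ _r in s..t, lap (μ 0) 0 := by
    refine intervalIntegral.integral_mono_on hst (hw.intervalIntegrable_mass hs hst)
      intervalIntegrable_const fun r hr => ?_
    have hr0 := hs.trans hr.1
    have h1 := hw.lap_le_mass hr0 le_rfl
    rw [ungel_zero] at h1
    -- Nonnegativity of the gel integral makes the Flory mass at most the mass of the rescaled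
    -- measure, hence at most the initial mass.
    refine (mul_le_of_le_one_left (lap_nonneg _ _) ?_).trans h1
    exact Real.exp_le_one_iff.2 (neg_nonpos.2 (h.gelIntegral_nonneg hmass hr0))
  rw [intervalIntegral.integral_const, smul_eq_mul] at hle
  rw [h.gelIntegral_eq hs, h.gelIntegral_eq ht]
  linarith

/-- Since W ≤ t ≤ T_gel, the minimizer is 0 and A = g_0(0) W. The comparison then runs in the
opposite direction, giving W ≥ t and K ≤ 0. -/
theorem gelIntegral_eq_zero (h : SolvesFlory μ) (hmass : firstMoment (μ 0) < ∞)
    {t : ℝ} (ht : 0 ≤ t) (hgel : ENNReal.ofReal t ≤ gelationTime (μ 0)) :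
    gelIntegral μ t = 0 := by
  have hw := h.weightedSolution hmass
  have hkey : ∀ s ∈ Icc 0 t, lap (μ 0) 0 * (∫ r in (0 : ℝ)..s, Real.exp (-gelIntegral μ r))
      - lap (μ 0) 0 * s ≤ -gelIntegral μ s := by
    intro s hs
    have := hw.mul_le_mass_integral hs.1 (by
      rw [ungel_zero]
      exact (ENNReal.ofReal_le_ofReal ((h.weight_integral_le hmass hs.1).trans hs.2)).trans hgel)
    rw [ungel_zero] at this
    rw [h.gelIntegral_eq hs.1]
    linarith
  have h1 := le_integral_of_exp_le h.continuous_exp_neg_gelIntegral (lap_nonneg (μ 0) 0) ht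
    fun s hs => Real.exp_le_exp.2 (hkey s hs)
  have h2 := hkey t ⟨ht, le_rfl⟩
  have h3 := mul_le_mul_of_nonneg_left h1 (lap_nonneg (μ 0) 0)
  exact le_antisymm (by linarith) (h.gelIntegral_nonneg hmass ht)

/-- If K(t) were not positive, K would vanish on [0, t], so W = t and A = g_0(0) t. Then 0 would be
a minimizer for weight t, forcing t ≤ T_gel. -/
theorem gelIntegral_pos (h : SolvesFlory μ) (hmass : firstMoment (μ 0) < ∞)
    {t : ℝ} (ht : 0 < t) (hgel : gelationTime (μ 0) < ENNReal.ofReal t) :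
    0 < gelIntegral μ t := by
  by_contra hcon
  have hw := h.weightedSolution hmass
  have hzero : ∀ s ∈ Icc 0 t, gelIntegral μ s = 0 := fun s hs => le_antisymm
    ((h.gelIntegral_mono hmass hs.1 hs.2).trans (not_lt.1 hcon)) (h.gelIntegral_nonneg hmass hs.1)
  have hW : ∫ s in (0 : ℝ)..t, Real.exp (-gelIntegral μ s) = t := by
    have : EqOn (fun s => Real.exp (-gelIntegral μ s)) (fun _ => (1 : ℝ)) (uIcc 0 t) :=
      fun s hs => by
        rw [uIcc_of_le ht.le] at hs
        simp [hzero s hs]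
    rw [intervalIntegral.integral_congr this]
    simp
  refine absurd (hw.hasMass_zero.le_gelationTime_of_isMin ht fun y hy => ?_) (by
    rw [ungel_zero]; exact not_le.2 hgel)
  have h1 := hw.mass_integral_le ht.le hy
  have h2 := h.gelIntegral_eq ht.le
  rw [hzero t ⟨ht.le, le_rfl⟩] at h2
  rw [hW] at h1
  rw [ungel_zero] at h1 ⊢
  linarith

end SolvesFlory

end Coagulation

theorem mainTheorem8
    (μ₀ : Measure Coagulation.MassSpace) (hμ₀ : IsLocallyFiniteMeasure μ₀)
    (hmass : Coagulation.firstMoment μ₀ < ∞)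
    (μS μF : ℝ → Measure Coagulation.MassSpace)
    (hS : Coagulation.SolvesSmoluchowski μS) (hS₀ : μS 0 = μ₀)
    (hF : Coagulation.SolvesFlory μF) (hF₀ : μF 0 = μ₀) :
    (∀ t : ℝ, 0 ≤ t → ENNReal.ofReal t ≤ Coagulation.gelationTime μ₀ → μS t = μF t) ∧
    (∀ t : ℝ, 0 ≤ t → Coagulation.gelationTime μ₀ < ENNReal.ofReal t →
      Coagulation.firstMoment (μF t) < Coagulation.firstMoment (μS t)) := by
  open Coagulation in
  subst hF₀
  have hwS := hS.weightedSolution (hS₀ ▸ hmass)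
  have hwF := hF.weightedSolution hmass
  refine ⟨fun t ht hgel => ?_, fun t ht hgel => ?_⟩
  · have hzero : ∀ s ∈ Set.Icc 0 t, gelIntegral μF s = 0 := fun s hs =>
      hF.gelIntegral_eq_zero hmass hs.1 ((ENNReal.ofReal_le_ofReal hs.2).trans hgel)
    have hW : ∫ _s in (0 : ℝ)..t, (1 : ℝ) = ∫ s in (0 : ℝ)..t, Real.exp (-gelIntegral μF s) :=
      intervalIntegral.integral_congr fun s hs => by
        rw [Set.uIcc_of_le ht] at hs
        simp [hzero s hs]
    rw [hwS.eq_of_weight_eq hwF (by rw [hS₀, SolvesFlory.ungel_zero]) ht hW, ungel,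
      hzero t ⟨ht, le_rfl⟩]
    simp
  · have ht0 : 0 < t := ENNReal.ofReal_pos.1 (zero_le.trans_lt hgel)
    have hne : μF 0 ≠ 0 := by
      intro h0
      simp [gelationTime, secondMoment, h0] at hgel
    have hK := hF.gelIntegral_pos hmass ht0 hgel
    have hD := hF.continuous_exp_neg_gelIntegral
    -- The speed e^{-K} is nonincreasing and strictly larger at time 0 than at t, so its final value
    -- lies strictly below its average.
    have hlt : t * Real.exp (-gelIntegral μF t) <
        ∫ s in (0 : ℝ)..t, Real.exp (-gelIntegral μF s) := by
      have := intervalIntegral.integral_lt_integral_of_continuousOn_of_le_of_exists_lt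
        (f := fun _ => Real.exp (-gelIntegral μF t)) ht0 continuousOn_const hD.continuousOn
        (fun s hs => Real.exp_le_exp.2 (neg_le_neg (hF.gelIntegral_mono hmass hs.1.le hs.2)))
        ⟨0, ⟨le_rfl, ht⟩, Real.exp_lt_exp.2 (by
          rw [SolvesFlory.gelIntegral_zero]; linarith)⟩
      simpa using this
    obtain ⟨l₁, hl₁, e₁, hmin₁⟩ := hwF.exists_isMin ht
    obtain ⟨l₂, hl₂, e₂, hmin₂⟩ := hwS.exists_isMin ht
    have hone : ∫ _s in (0 : ℝ)..t, (1 : ℝ) = t := by simp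
    rw [hone, hS₀] at hmin₂
    rw [hS₀] at e₂
    rw [SolvesFlory.ungel_zero] at hmin₁ e₁
    have hmass' := hasMass_iff.2 hmass
    -- Minimizers are compared at the weights W ≤ t.
    have hcomp := hmass'.mul_lap_le_of_isMin hne
      ((mul_pos ht0 (Real.exp_pos _)).trans hlt) (hF.weight_integral_le hmass ht) hl₁ hl₂
      hmin₁ hmin₂
    have hpos := hmass'.lap_pos hne hl₁
    have hmF : HasMass (μF t) := by
      have := hasMass_iff.1 (hwF.hasMass ht)
      rw [ungel, firstMoment_smul] at this
      refine hasMass_iff.2 (ENNReal.lt_top_of_mul_ne_top_right this.ne ?_)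
      simpa using Real.exp_pos _
    have hmS := hwS.hasMass ht
    rw [← hmF.ofReal_lap_zero, ← hmS.ofReal_lap_zero]
    have hFl : lap (μF t) 0 = Real.exp (-gelIntegral μF t) * lap (μF 0) l₁ := by
      rw [e₁, SolvesFlory.lap_ungel, ← mul_assoc, ← Real.exp_add, neg_add_cancel, Real.exp_zero,
        one_mul]
    have hstrict : lap (μF t) 0 < lap (μS t) 0 := by
      rw [hFl, ← e₂]
      have := mul_lt_mul_of_pos_right hlt hpos
      refine lt_of_mul_lt_mul_left ?_ ht
      linarith
    exact (ENNReal.ofReal_lt_ofReal_iff ((lap_nonneg _ _).trans_lt hstrict)).2 hstrict
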